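/- There are a program for a random access machine and a constant $C$ such that the following holds for all integers $n, k, f \ge 0$. Let $G=(V,E)$ be an interval graph on $n$ vertices, given by an interval representation, that is, by closed intervals $[\ell_v, r_v]\subseteq\mathbb{R}$, $v\in V$ (in arbitrary order), such that two distinct vertices are adjacent if and only if their intervals intersect. Let $\gamma\colon V\to\{1,\dots,k\}$ be any color assignment (adjacent vertices may have the same color). Given the endpoints of the intervals, $\gamma$, $k$ and $f$, the program computes an $f$-balanced independent set of $G$, i.e., an independent set of $G$ that contains exactly $f$ vertices of each of the $k$ colors, or determines that no such set exists, in at most $$C\cdot\bigl(n\log n + k\,(f+1)^k\, n + 1\bigr)$$ time steps (the summand $1$ matters only for $n=0$; so the running time is $O(n\log n + k(f+1)^k n)$). Here a time step is one operation of the uniform-cost random access machine: an addition or (truncated) subtraction of natural numbers, a comparison of two natural numbers or of two interval endpoints, a memory access, or a control instruction. -/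

import Mathlib

/-! ### Interval graphs and balanced independent sets -/

/-- An interval representation of `G`: every vertex `v` gets a nonempty closed interval
`[left v, right v]` of the real line, and two distinct vertices are adjacent if and only if their
intervals meet. A graph is an interval graph when it has such a representation. -/
structure IntervalRep {V : Type*} (G : SimpleGraph V) where
  left : V → ℝ
  right : V → ℝ
  left_le_right : ∀ v, left v ≤ right v
  adj_iff : ∀ u v, u ≠ v →
    (G.Adj u v ↔ (Set.Icc (left u) (right u) ∩ Set.Icc (left v) (right v)).Nonempty)

/-- `S` is an `f`-balanced independent set of `G` for the color assignment `γ` (any map, adjacent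
vertices may share a color): `S` is independent and has exactly `f` elements of each color. -/
def IsBalancedIndepSet {V C : Type*} [DecidableEq C] (G : SimpleGraph V) (γ : V → C) (f : ℕ)
    (S : Finset V) : Prop :=
  G.IsIndepSet (S : Set V) ∧ ∀ c : C, (S.filter (fun v => γ v = c)).card = f

/-- The correct answers to an instance: an `f`-balanced independent set, or `none` when there is
no such set. -/
def IsCorrectAnswer {V C : Type*} [DecidableEq C] (G : SimpleGraph V) (γ : V → C) (f : ℕ) :
    Option (Finset V) → Prop
  | some S => IsBalancedIndepSet G γ f S
  | none => ¬ ∃ S : Finset V, IsBalancedIndepSet G γ f S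

/-! ### The machine model

A random access machine with the uniform cost measure. It has scalar variables and one-dimensional
arrays, both holding natural numbers (a program mentions only finitely many of either), and
addition and truncated subtraction as its only arithmetic. Besides, there are read-only input
arrays of real numbers; the only thing that a program can do with a real number is to compare it
with another one. Every operation on numbers, every memory access, every comparison and every
instruction costs one time unit. -/

namespace RAM

/-- The writable memory: `var x` is the value of variable `x`, and `arr a i` is the entry number
`i` of array `a`. -/
structure State where
  var : ℕ → ℕ
  arr : ℕ → ℕ → ℕ

/-- `x := m`. -/
def State.setVar (s : State) (x m : ℕ) : State :=
  { s with var := Function.update s.var x m }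

/-- `a[i] := m`. -/
def State.setArr (s : State) (a i m : ℕ) : State :=
  { s with arr := Function.update s.arr a (Function.update (s.arr a) i m) }

/-- Arithmetic expressions: numerals, variables, array entries, sums, truncated differences. -/
inductive Expr where
  | num (c : ℕ)
  | var (x : ℕ)
  | get (a : ℕ) (i : Expr)
  | add (e₁ e₂ : Expr)
  | sub (e₁ e₂ : Expr)

/-- The value of an expression. -/
def Expr.eval (s : State) : Expr → ℕ
  | num c => c
  | var x => s.var x
  | get a i => s.arr a (i.eval s)
  | add e₁ e₂ => e₁.eval s + e₂.eval s
  | sub e₁ e₂ => e₁.eval s - e₂.eval s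

/-- The number of time units taken by the evaluation of an expression. -/
def Expr.cost : Expr → ℕ
  | num _ => 1
  | var _ => 1
  | get _ i => i.cost + 1
  | add e₁ e₂ => e₁.cost + e₂.cost + 1
  | sub e₁ e₂ => e₁.cost + e₂.cost + 1

/-- Conditions: comparisons of natural numbers, comparisons of two entries of the read-only real
arrays, and Boolean combinations. -/
inductive Test where
  | eq (e₁ e₂ : Expr)
  | lt (e₁ e₂ : Expr)
  | realLe (a : ℕ) (i : Expr) (b : ℕ) (j : Expr)
  | not (b : Test)
  | and (b₁ b₂ : Test)

/-- Truth of a condition; `inp a i` is the entry number `i` of the real input array `a`. -/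
def Test.Holds (inp : ℕ → ℕ → ℝ) (s : State) : Test → Prop
  | eq e₁ e₂ => e₁.eval s = e₂.eval s
  | lt e₁ e₂ => e₁.eval s < e₂.eval s
  | realLe a i b j => inp a (i.eval s) ≤ inp b (j.eval s)
  | not b => ¬ b.Holds inp s
  | and b₁ b₂ => b₁.Holds inp s ∧ b₂.Holds inp s

/-- The number of time units taken by the evaluation of a condition. -/
def Test.cost : Test → ℕ
  | eq e₁ e₂ => e₁.cost + e₂.cost + 1
  | lt e₁ e₂ => e₁.cost + e₂.cost + 1
  | realLe _ i _ j => i.cost + j.cost + 1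
  | not b => b.cost + 1
  | and b₁ b₂ => b₁.cost + b₂.cost + 1

/-- Programs. -/
inductive Program where
  | skip
  | assign (x : ℕ) (e : Expr)
  | store (a : ℕ) (i e : Expr)
  | seq (p q : Program)
  | branch (b : Test) (p q : Program)
  | loop (b : Test) (p : Program)

/-- `Exec inp p s s' t`: on the real input arrays `inp`, the program `p` started in state `s` halts
in state `s'` after exactly `t` time units. -/
inductive Exec (inp : ℕ → ℕ → ℝ) : Program → State → State → ℕ → Prop where
  | skip (s : State) : Exec inp Program.skip s s 1
  | assign (x : ℕ) (e : Expr) (s : State) :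
      Exec inp (Program.assign x e) s (s.setVar x (e.eval s)) (e.cost + 1)
  | store (a : ℕ) (i e : Expr) (s : State) :
      Exec inp (Program.store a i e) s (s.setArr a (i.eval s) (e.eval s)) (i.cost + e.cost + 1)
  | seq {p q : Program} {s₁ s₂ s₃ : State} {t₁ t₂ : ℕ} :
      Exec inp p s₁ s₂ t₁ → Exec inp q s₂ s₃ t₂ → Exec inp (Program.seq p q) s₁ s₃ (t₁ + t₂)
  | branch_true {b : Test} {p q : Program} {s s' : State} {t : ℕ} :
      b.Holds inp s → Exec inp p s s' t → Exec inp (Program.branch b p q) s s' (b.cost + t + 1)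
  | branch_false {b : Test} {p q : Program} {s s' : State} {t : ℕ} :
      ¬ b.Holds inp s → Exec inp q s s' t → Exec inp (Program.branch b p q) s s' (b.cost + t + 1)
  | loop_true {b : Test} {p : Program} {s₁ s₂ s₃ : State} {t₁ t₂ : ℕ} :
      b.Holds inp s₁ → Exec inp p s₁ s₂ t₁ → Exec inp (Program.loop b p) s₂ s₃ t₂ →
      Exec inp (Program.loop b p) s₁ s₃ (b.cost + t₁ + t₂ + 1)
  | loop_false {b : Test} {p : Program} {s : State} :
      ¬ b.Holds inp s → Exec inp (Program.loop b p) s s (b.cost + 1)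

/-- The machine is deterministic: final state and running time are determined by program, input and
initial state. -/
theorem Exec.deterministic {inp : ℕ → ℕ → ℝ} {p : Program} {s s₁ s₂ : State} {t₁ t₂ : ℕ}
    (h₁ : Exec inp p s s₁ t₁) (h₂ : Exec inp p s s₂ t₂) : s₁ = s₂ ∧ t₁ = t₂ := by
  induction h₁ generalizing s₂ t₂ with
  | skip s => cases h₂; exact ⟨rfl, rfl⟩
  | assign x e s => cases h₂; exact ⟨rfl, rfl⟩
  | store a i e s => cases h₂; exact ⟨rfl, rfl⟩
  | seq _ _ ih₁ ih₂ =>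
    cases h₂ with
    | seq h h' =>
      obtain ⟨rfl, rfl⟩ := ih₁ h
      obtain ⟨rfl, rfl⟩ := ih₂ h'
      exact ⟨rfl, rfl⟩
  | branch_true hb _ ih =>
    cases h₂ with
    | branch_true _ h => obtain ⟨rfl, rfl⟩ := ih h; exact ⟨rfl, rfl⟩
    | branch_false hn _ => exact absurd hb hn
  | branch_false hb _ ih =>
    cases h₂ with
    | branch_true hn _ => exact absurd hn hb
    | branch_false _ h => obtain ⟨rfl, rfl⟩ := ih h; exact ⟨rfl, rfl⟩
  | loop_true hb _ _ ih₁ ih₂ =>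
    cases h₂ with
    | loop_true _ h h' =>
      obtain ⟨rfl, rfl⟩ := ih₁ h
      obtain ⟨rfl, rfl⟩ := ih₂ h'
      exact ⟨rfl, rfl⟩
    | loop_false hn => exact absurd hb hn
  | loop_false hb =>
    cases h₂ with
    | loop_true hn _ _ => exact absurd hn hb
    | loop_false _ => exact ⟨rfl, rfl⟩

end RAM

/-! ### Input and output -/

/-- The real input arrays of an instance: array `0` holds the left endpoints and array `1` the right
endpoints of the intervals, in the order of the vertices (in no way sorted); all else is `0`. -/
noncomputable def IntervalRep.inputReals {n : ℕ} {G : SimpleGraph (Fin n)} (R : IntervalRep G) :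
    ℕ → ℕ → ℝ := fun a i =>
  if h : i < n then
    if a = 0 then R.left ⟨i, h⟩ else if a = 1 then R.right ⟨i, h⟩ else 0
  else 0

/-- The initial memory: variables `0`, `1`, `2` hold the number `n` of vertices, the number `k` of
colors and `f`, and array `0` holds the colors of the vertices; all else is `0`. -/
def initialState {n k : ℕ} (γ : Fin n → Fin k) (f : ℕ) : RAM.State where
  var := fun x => if x = 0 then n else if x = 1 then k else if x = 2 then f else 0
  arr := fun a i => if h : i < n then if a = 0 then (γ ⟨i, h⟩ : ℕ) else 0 else 0

/-- The answer read off the final memory: if variable `0` is `0`, the machine claims that there is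
no solution; otherwise it returns the set of the vertices whose entry in array `1` is not `0`. -/
def readAnswer (n : ℕ) (s : RAM.State) : Option (Finset (Fin n)) :=
  if s.var 0 = 0 then none else some (Finset.univ.filter fun v : Fin n => s.arr 1 v ≠ 0)

/-! Give color `c` the weight `(f + 1) ^ c`. A balanced set has weight `(f + 1) ^ k - 1` and `k * f`
elements. Conversely, among all ways to write `(f + 1) ^ k - 1` as a sum of such powers, using every
power `f` times is the only one with at most `k * f` summands, because each carry in base `f + 1`
trades `f + 1` summands for one (`balanced_iff`). So `k` color counts are replaced by a single
number below `(f + 1) ^ k`, and it suffices to find the least cardinality of an independent set of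
the target weight.

With the vertices ordered by right endpoints, the vertices lying entirely to the left of `v` form an
initial segment, of length `p v`. A smallest set of weight `m` among the first `i + 1` vertices
either avoids the last vertex `v` or consists of `v` and a smallest set of weight `m - wt v` among
the first `p v`; this is the recursion `minSize`. That its values are lower bounds is
`minSize_le_card`. That values up to `k * f` are attained is never proved separately: the traceback,
with invariant `TraceInv`, builds the set.

Sorting costs `O(n log n)`, the powers `O(k (f + 1))`, the lengths `p v` `O(n)` by a sweep, and the
table constant time per entry. The machine does not multiply, so row offsets `p v * (f + 1) ^ k` are
accumulated by addition. Time is tracked by a program logic whose loop rule `wp_loop` combines an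
invariant with a potential. -/

namespace RAM

/-! ### Program logic with running times -/

@[simp] theorem State.setVar_var (s : State) (x m y : ℕ) :
    (s.setVar x m).var y = if y = x then m else s.var y := by
  simp [State.setVar, Function.update_apply]

@[simp] theorem State.setVar_arr (s : State) (x m : ℕ) : (s.setVar x m).arr = s.arr := rfl

@[simp] theorem State.setArr_var (s : State) (a i m : ℕ) : (s.setArr a i m).var = s.var := rfl

@[simp] theorem State.setArr_arr (s : State) (a i m b : ℕ) :
    (s.setArr a i m).arr b = if b = a then Function.update (s.arr a) i m else s.arr b := by
  simp [State.setArr, Function.update_apply]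

/-- The variable `x` is assigned somewhere in the program. -/
def Program.writesVar (x : ℕ) : Program → Bool
  | skip => false
  | assign y _ => x == y
  | store _ _ _ => false
  | seq p q => p.writesVar x || q.writesVar x
  | branch _ p q => p.writesVar x || q.writesVar x
  | loop _ p => p.writesVar x

/-- The array `a` is written somewhere in the program. -/
def Program.writesArr (a : ℕ) : Program → Bool
  | skip => false
  | assign _ _ => false
  | store b _ _ => a == b
  | seq p q => p.writesArr a || q.writesArr a
  | branch _ p q => p.writesArr a || q.writesArr a
  | loop _ p => p.writesArr a

/-- `s` and `s'` agree on all variables and arrays that `p` does not write. -/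
structure Frame (p : Program) (s s' : State) : Prop where
  var : ∀ x, p.writesVar x = false → s'.var x = s.var x
  arr : ∀ a, p.writesArr a = false → s'.arr a = s.arr a

/-- The side conditions of `Frame` are Boolean computations, so `rfl` settles them for concrete
programs and indices. Loop invariants then need to mention only what the loop changes. -/
theorem Exec.frame {inp : ℕ → ℕ → ℝ} {p : Program} {s s' : State} {t : ℕ}
    (h : Exec inp p s s' t) : Frame p s s' := by
  induction h with
  | skip s => exact ⟨fun _ _ => rfl, fun _ _ => rfl⟩
  | assign x e s =>
    refine ⟨fun y hy => ?_, fun _ _ => rfl⟩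
    simp only [Program.writesVar, beq_eq_false_iff_ne] at hy
    simp [hy]
  | store a i e s =>
    refine ⟨fun _ _ => rfl, fun b hb => ?_⟩
    simp only [Program.writesArr, beq_eq_false_iff_ne] at hb
    simp [hb]
  | seq _ _ ih₁ ih₂ =>
    refine ⟨fun x hx => ?_, fun a ha => ?_⟩
    · simp only [Program.writesVar, Bool.or_eq_false_iff] at hx
      rw [ih₂.var x hx.2, ih₁.var x hx.1]
    · simp only [Program.writesArr, Bool.or_eq_false_iff] at ha
      rw [ih₂.arr a ha.2, ih₁.arr a ha.1]
  | branch_true _ _ ih =>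
    refine ⟨fun x hx => ?_, fun a ha => ?_⟩
    · simp only [Program.writesVar, Bool.or_eq_false_iff] at hx
      exact ih.var x hx.1
    · simp only [Program.writesArr, Bool.or_eq_false_iff] at ha
      exact ih.arr a ha.1
  | branch_false _ _ ih =>
    refine ⟨fun x hx => ?_, fun a ha => ?_⟩
    · simp only [Program.writesVar, Bool.or_eq_false_iff] at hx
      exact ih.var x hx.2
    · simp only [Program.writesArr, Bool.or_eq_false_iff] at ha
      exact ih.arr a ha.2
  | loop_true _ _ _ ih₁ ih₂ =>
    exact ⟨fun x hx => (ih₂.var x hx).trans (ih₁.var x hx),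
      fun a ha => (ih₂.arr a ha).trans (ih₁.arr a ha)⟩
  | loop_false _ => exact ⟨fun _ _ => rfl, fun _ _ => rfl⟩

/-- The program `p`, started in `s` at time `t`, halts in a state and at a time that satisfy `Q`. -/
def WP (inp : ℕ → ℕ → ℝ) (p : Program) (Q : State → ℕ → Prop) (s : State) (t : ℕ) : Prop :=
  ∃ s' t', Exec inp p s s' t' ∧ Q s' (t + t')

variable {inp : ℕ → ℕ → ℝ} {p q : Program} {Q : State → ℕ → Prop} {s : State} {t : ℕ}

theorem wp_skip (h : Q s (t + 1)) : WP inp .skip Q s t := ⟨s, 1, .skip s, h⟩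

theorem wp_assign {x : ℕ} {e : Expr} (h : Q (s.setVar x (e.eval s)) (t + (e.cost + 1))) :
    WP inp (.assign x e) Q s t := ⟨_, _, .assign x e s, h⟩

theorem wp_store {a : ℕ} {i e : Expr}
    (h : Q (s.setArr a (i.eval s) (e.eval s)) (t + (i.cost + e.cost + 1))) :
    WP inp (.store a i e) Q s t := ⟨_, _, .store a i e s, h⟩

theorem wp_seq (h : WP inp p (WP inp q Q) s t) : WP inp (.seq p q) Q s t := by
  obtain ⟨s₁, t₁, h₁, s₂, t₂, h₂, h⟩ := h
  exact ⟨s₂, t₁ + t₂, .seq h₁ h₂, by rwa [← add_assoc]⟩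

theorem wp_branch {b : Test} (h₁ : b.Holds inp s → WP inp p Q s (t + b.cost + 1))
    (h₂ : ¬ b.Holds inp s → WP inp q Q s (t + b.cost + 1)) : WP inp (.branch b p q) Q s t := by
  by_cases hb : b.Holds inp s
  · obtain ⟨s', t', h, hQ⟩ := h₁ hb
    exact ⟨s', _, .branch_true hb h, by convert hQ using 1; ring⟩
  · obtain ⟨s', t', h, hQ⟩ := h₂ hb
    exact ⟨s', _, .branch_false hb h, by convert hQ using 1; ring⟩

/-- The loop rule: `Inv` is an invariant, and the potential `φ` pays for every pass. -/
theorem wp_loop {b : Test} (Inv : State → Prop) (φ : State → ℕ) (h₀ : Inv s)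
    (step : ∀ s', Frame p s s' → Inv s' → b.Holds inp s' →
      WP inp p (fun s'' t' => Inv s'' ∧ t' + b.cost + 1 + φ s'' ≤ φ s') s' 0)
    (post : ∀ s' t', Frame p s s' → Inv s' → ¬ b.Holds inp s' →
      t' ≤ t + (φ s + b.cost + 1) → Q s' t') :
    WP inp (.loop b p) Q s t := by
  -- A pass lowers the potential by at least one, since the test alone costs time; strong induction
  -- on the potential therefore gives termination together with the time bound.
  have key : ∀ m : ℕ, ∀ s', φ s' = m → Frame p s s' → Inv s' →
      ∃ s'' t'', Exec inp (.loop b p) s' s'' t'' ∧ Inv s'' ∧ ¬ b.Holds inp s'' ∧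
        t'' ≤ φ s' + b.cost + 1 := by
    intro m
    induction m using Nat.strong_induction_on with
    | _ m ih =>
      intro s' hm hF hI
      by_cases hb : b.Holds inp s'
      · obtain ⟨s₁, t₁, h₁, hI₁, ht₁⟩ := step s' hF hI hb
        have hF₁ : Frame p s s₁ := ⟨fun x hx => (h₁.frame.var x hx).trans (hF.var x hx),
          fun a ha => (h₁.frame.arr a ha).trans (hF.arr a ha)⟩
        obtain ⟨s₂, t₂, h₂, hI₂, hb₂, ht₂⟩ := ih (φ s₁) (by omega) s₁ rfl hF₁ hI₁
        exact ⟨s₂, _, .loop_true hb h₁ h₂, hI₂, hb₂, by omega⟩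
      · exact ⟨s', _, .loop_false hb, hI, hb, by omega⟩
  obtain ⟨s', t', h, hI, hb, ht⟩ := key _ s rfl ⟨fun _ _ => rfl, fun _ _ => rfl⟩ h₀
  exact ⟨s', t', h, post s' _ ⟨h.frame.var, h.frame.arr⟩ hI hb (by omega)⟩

/-- The program `p`, started in `s`, halts within `T` steps in a state that satisfies `R`. -/
def Runs (inp : ℕ → ℕ → ℝ) (p : Program) (s : State) (T : ℕ) (R : State → Prop) : Prop :=
  WP inp p (fun s' t => R s' ∧ t ≤ T) s 0

/-- Lets a specification proved from time `0` be used at any point of a larger program; unwritten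
memory is recovered from the frame. -/
theorem Runs.wp {T : ℕ} {R : State → Prop} (h : Runs inp p s T R)
    (hQ : ∀ s' t', Frame p s s' → R s' → t' ≤ t + T → Q s' t') : WP inp p Q s t := by
  obtain ⟨s', t', h, hR, ht⟩ := h
  exact ⟨s', t', h, hQ s' _ h.frame hR (by omega)⟩

end RAM

/-! ### Merge sort of the endpoints -/

namespace RAM

/-- One comparison of a merge: the next entry of array `2` is taken from the run of array `A` that
starts at `var 7` or from the one that starts at `var 8`. -/
def mergeStep (a A : ℕ) : Program :=
  -- The left run is used if it is not exhausted and the right run is exhausted or has no smaller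
  -- head; the disjunction is expressed by negations.
  .seq (.branch (.and (.lt (.var 7) (.var 5)) (.not (.and (.lt (.var 8) (.var 6))
      (.not (.realLe a (.get A (.var 7)) a (.get A (.var 8)))))))
    (.seq (.store 2 (.var 4) (.get A (.var 7))) (.assign 7 (.add (.var 7) (.num 1))))
    (.seq (.store 2 (.var 4) (.get A (.var 8))) (.assign 8 (.add (.var 8) (.num 1)))))
    (.assign 4 (.add (.var 4) (.num 1)))

/-- Merges the runs `[lo, lo + w)` and `[lo + w, lo + 2 w)` of array `A` into array `2`, where `w` is
`var 3` and `lo` is `var 4`. -/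
def mergeRuns (a A : ℕ) : Program :=
  -- With truncated subtraction, `x - (x - n)` is `min x n`; this clips both runs at `n`.
  .seq (.assign 5 (.sub (.add (.var 4) (.var 3)) (.sub (.add (.var 4) (.var 3)) (.var 0))))
  (.seq (.assign 6 (.sub (.add (.var 5) (.var 3)) (.sub (.add (.var 5) (.var 3)) (.var 0))))
  (.seq (.assign 7 (.var 4))
  (.seq (.assign 8 (.var 5))
  (.loop (.lt (.var 4) (.var 6)) (mergeStep a A)))))

/-- `dst[i] := e` for all `i < n`, with `var 4` as the counter. -/
def fill (dst : ℕ) (e : Expr) : Program :=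
  .seq (.assign 4 (.num 0))
  (.loop (.lt (.var 4) (.var 0))
    (.seq (.store dst (.var 4) e) (.assign 4 (.add (.var 4) (.num 1)))))

/-- Doubles the length of the sorted runs of array `A`. -/
def mergePass (a A : ℕ) : Program :=
  .seq (.assign 4 (.num 0))
  (.seq (.loop (.lt (.var 4) (.var 0)) (mergeRuns a A)) (fill A (.get 2 (.var 4))))

/-- Bottom-up merge sort: array `A` receives the numbers below `n` in the order of their entries in
the real array `a`. -/
def mergeSort (a A : ℕ) : Program :=
  .seq (fill A (.var 4))
  (.seq (.assign 3 (.num 1))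
  (.loop (.lt (.var 3) (.var 0)) (.seq (mergePass a A) (.assign 3 (.add (.var 3) (.var 3))))))

variable {inp : ℕ → ℕ → ℝ}

/-- The invariant of the merge of the runs `[b, mid)` and `[mid, hi)` of `A` into array `2`, whose
entries below `b` are those of `B`. -/
structure MergeInv (κ : ℕ → ℝ) (A B : ℕ → ℕ) (b mid hi : ℕ) (s : State) : Prop where
  le_i : b ≤ s.var 7
  i_le : s.var 7 ≤ mid
  le_j : mid ≤ s.var 8
  j_le : s.var 8 ≤ hi
  out_eq : s.var 4 + mid = s.var 7 + s.var 8
  below : ∀ x < b, s.arr 2 x = B x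
  sorted : ∀ x y, b ≤ x → x ≤ y → y < s.var 4 → κ (s.arr 2 x) ≤ κ (s.arr 2 y)
  le_left : ∀ x y, b ≤ x → x < s.var 4 → s.var 7 ≤ y → y < mid → κ (s.arr 2 x) ≤ κ (A y)
  le_right : ∀ x y, b ≤ x → x < s.var 4 → s.var 8 ≤ y → y < hi → κ (s.arr 2 x) ≤ κ (A y)
  mem : ∀ x, b ≤ x → x < s.var 4 → ∃ y, b ≤ y ∧ y < hi ∧ s.arr 2 x = A y
  surj_left : ∀ y, b ≤ y → y < s.var 7 → ∃ x, b ≤ x ∧ x < s.var 4 ∧ s.arr 2 x = A y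
  surj_right : ∀ y, mid ≤ y → y < s.var 8 → ∃ x, b ≤ x ∧ x < s.var 4 ∧ s.arr 2 x = A y

/-- The head that is output is at most every entry left in either run (`hl`, `hr`), which keeps the
output sorted and below the rest. `MergeInv.right` is the mirror image. -/
theorem MergeInv.left {κ : ℕ → ℝ} {A B : ℕ → ℕ} {b mid hi : ℕ} {s s' : State}
    (h : MergeInv κ A B b mid hi s) (hi' : s.var 7 < mid) (h4 : s'.var 4 = s.var 4 + 1)
    (h7 : s'.var 7 = s.var 7 + 1) (h8 : s'.var 8 = s.var 8)
    (h2 : s'.arr 2 = Function.update (s.arr 2) (s.var 4) (A (s.var 7)))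
    (hl : ∀ y, s.var 7 ≤ y → y < mid → κ (A (s.var 7)) ≤ κ (A y))
    (hr : ∀ y, s.var 8 ≤ y → y < hi → κ (A (s.var 7)) ≤ κ (A y)) :
    MergeInv κ A B b mid hi s' := by
  obtain ⟨g1, g2, g3, g4, g5, g6, g7, g8, g9, g10, g11, g12⟩ := h
  have hnew : s'.arr 2 (s.var 4) = A (s.var 7) := by simp [h2]
  have hold : ∀ x, x ≠ s.var 4 → s'.arr 2 x = s.arr 2 x := fun x hx => by simp [h2, hx]
  have hcase : ∀ x, x < s'.var 4 → x < s.var 4 ∧ s'.arr 2 x = s.arr 2 x ∨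
      x = s.var 4 ∧ s'.arr 2 x = A (s.var 7) := fun x hx => by
    rcases Nat.lt_succ_iff_lt_or_eq.1 (h4 ▸ hx : x < s.var 4 + 1) with hx | rfl
    · exact .inl ⟨hx, hold x hx.ne⟩
    · exact .inr ⟨rfl, hnew⟩
  clear h2
  refine ⟨by omega, by omega, by omega, by omega, by omega, ?_, ?_, ?_, ?_, ?_, ?_, ?_⟩
  · intro x hx
    rw [hold x (by omega), g6 x hx]
  · intro x y hx hxy hy
    rcases hcase y hy with ⟨hy, e⟩ | ⟨hy, e⟩
    · rw [hold x (by omega), e]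
      exact g7 x y hx hxy hy
    · rcases hcase x (by omega) with ⟨hx', e'⟩ | ⟨hx', e'⟩
      · rw [e, e']
        exact g8 x _ hx hx' le_rfl hi'
      · rw [hx', hy]
  · intro x y hx hx' hy hy'
    rcases hcase x hx' with ⟨hx', e⟩ | ⟨hx', e⟩ <;> rw [e]
    · exact g8 x y hx hx' (by omega) hy'
    · exact hl y (by omega) hy'
  · intro x y hx hx' hy hy'
    rcases hcase x hx' with ⟨hx', e⟩ | ⟨hx', e⟩ <;> rw [e]
    · exact g9 x y hx hx' (by omega) hy'
    · exact hr y (by omega) hy'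
  · intro x hx hx'
    rcases hcase x hx' with ⟨hx', e⟩ | ⟨hx', e⟩ <;> rw [e]
    · exact g10 x hx hx'
    · exact ⟨s.var 7, by omega, by omega, rfl⟩
  · intro y hy hy'
    rcases Nat.lt_succ_iff_lt_or_eq.1 (h7 ▸ hy' : y < s.var 7 + 1) with hy' | rfl
    · obtain ⟨x, hx, hx', e⟩ := g11 y hy hy'
      exact ⟨x, hx, by omega, by rw [hold x (by omega), e]⟩
    · exact ⟨s.var 4, by omega, by omega, hnew⟩
  · intro y hy hy'
    obtain ⟨x, hx, hx', e⟩ := g12 y hy (by omega)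
    exact ⟨x, hx, by omega, by rw [hold x (by omega), e]⟩

theorem MergeInv.right {κ : ℕ → ℝ} {A B : ℕ → ℕ} {b mid hi : ℕ} {s s' : State}
    (h : MergeInv κ A B b mid hi s) (hi' : s.var 8 < hi) (h4 : s'.var 4 = s.var 4 + 1)
    (h7 : s'.var 7 = s.var 7) (h8 : s'.var 8 = s.var 8 + 1)
    (h2 : s'.arr 2 = Function.update (s.arr 2) (s.var 4) (A (s.var 8)))
    (hl : ∀ y, s.var 7 ≤ y → y < mid → κ (A (s.var 8)) ≤ κ (A y))
    (hr : ∀ y, s.var 8 ≤ y → y < hi → κ (A (s.var 8)) ≤ κ (A y)) :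
    MergeInv κ A B b mid hi s' := by
  obtain ⟨g1, g2, g3, g4, g5, g6, g7, g8, g9, g10, g11, g12⟩ := h
  have hnew : s'.arr 2 (s.var 4) = A (s.var 8) := by simp [h2]
  have hold : ∀ x, x ≠ s.var 4 → s'.arr 2 x = s.arr 2 x := fun x hx => by simp [h2, hx]
  have hcase : ∀ x, x < s'.var 4 → x < s.var 4 ∧ s'.arr 2 x = s.arr 2 x ∨
      x = s.var 4 ∧ s'.arr 2 x = A (s.var 8) := fun x hx => by
    rcases Nat.lt_succ_iff_lt_or_eq.1 (h4 ▸ hx : x < s.var 4 + 1) with hx | rfl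
    · exact .inl ⟨hx, hold x hx.ne⟩
    · exact .inr ⟨rfl, hnew⟩
  clear h2
  refine ⟨by omega, by omega, by omega, by omega, by omega, ?_, ?_, ?_, ?_, ?_, ?_, ?_⟩
  · intro x hx
    rw [hold x (by omega), g6 x hx]
  · intro x y hx hxy hy
    rcases hcase y hy with ⟨hy, e⟩ | ⟨hy, e⟩
    · rw [hold x (by omega), e]
      exact g7 x y hx hxy hy
    · rcases hcase x (by omega) with ⟨hx', e'⟩ | ⟨hx', e'⟩
      · rw [e, e']
        exact g9 x _ hx hx' le_rfl hi'
      · rw [hx', hy]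
  · intro x y hx hx' hy hy'
    rcases hcase x hx' with ⟨hx', e⟩ | ⟨hx', e⟩ <;> rw [e]
    · exact g8 x y hx hx' (by omega) hy'
    · exact hl y (by omega) hy'
  · intro x y hx hx' hy hy'
    rcases hcase x hx' with ⟨hx', e⟩ | ⟨hx', e⟩ <;> rw [e]
    · exact g9 x y hx hx' (by omega) hy'
    · exact hr y (by omega) hy'
  · intro x hx hx'
    rcases hcase x hx' with ⟨hx', e⟩ | ⟨hx', e⟩ <;> rw [e]
    · exact g10 x hx hx'
    · exact ⟨s.var 8, by omega, by omega, rfl⟩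
  · intro y hy hy'
    obtain ⟨x, hx, hx', e⟩ := g11 y hy (by omega)
    exact ⟨x, hx, by omega, by rw [hold x (by omega), e]⟩
  · intro y hy hy'
    rcases Nat.lt_succ_iff_lt_or_eq.1 (h8 ▸ hy' : y < s.var 8 + 1) with hy' | rfl
    · obtain ⟨x, hx, hx', e⟩ := g12 y hy hy'
      exact ⟨x, hx, by omega, by rw [hold x (by omega), e]⟩
    · exact ⟨s.var 4, by omega, by omega, hnew⟩

theorem mergeStep_spec {a A : ℕ} {B : ℕ → ℕ} {b mid hi : ℕ} {s : State}
    (hmid : s.var 5 = mid) (hhi : s.var 6 = hi) (hlt : s.var 4 < hi)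
    (hl : ∀ x y, b ≤ x → x ≤ y → y < mid → inp a (s.arr A x) ≤ inp a (s.arr A y))
    (hr : ∀ x y, mid ≤ x → x ≤ y → y < hi → inp a (s.arr A x) ≤ inp a (s.arr A y))
    (h : MergeInv (inp a) (s.arr A) B b mid hi s) :
    Runs inp (mergeStep a A) s 40
      (fun s' => MergeInv (inp a) (s.arr A) B b mid hi s' ∧ s'.var 4 = s.var 4 + 1) := by
  have hsum := h.out_eq
  have hij := h.i_le
  have hjj := h.j_le
  refine wp_seq (wp_branch (fun hb => ?_) fun hb => ?_) <;>
    refine wp_seq (wp_store (wp_assign (wp_assign ?_)))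
  · simp only [Test.Holds, Expr.eval, hmid, hhi, not_and, not_not] at hb
    obtain ⟨hb1, hb2⟩ := hb
    refine ⟨⟨h.left hb1 ?_ ?_ ?_ ?_ (fun y hy hy' => hl _ _ h.le_i hy hy')
      fun y hy hy' => (hb2 (by omega)).trans (hr _ _ h.le_j hy hy'), ?_⟩, ?_⟩ <;>
      simp [Expr.eval, Expr.cost, Test.cost]
  · simp only [Test.Holds, Expr.eval, hmid, hhi, not_and, not_not] at hb
    -- Were the right run exhausted, `out_eq` and `var 4 < hi` would leave an entry in the left run,
    -- and the test would have succeeded.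
    have hj : s.var 8 < hi := by
      by_contra hj
      exact hb (by omega) fun h => absurd h hj
    refine ⟨⟨h.right hj ?_ ?_ ?_ ?_ (fun y hy hy' => ?_)
      (fun y hy hy' => hr _ _ h.le_j hy hy'), ?_⟩, ?_⟩
    case refine_5 =>
      have hlt' := Classical.not_imp.1 (hb (by omega))
      exact (not_le.1 hlt'.2).le.trans (hl _ _ h.le_i hy hy')
    all_goals simp [Expr.eval, Expr.cost, Test.cost]

theorem mergeRuns_spec {a A : ℕ} (hA : A ≠ 2) {n w b mid hi : ℕ} {s : State} (hn : s.var 0 = n)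
    (hw : s.var 3 = w) (hb : s.var 4 = b) (hmid : mid = min (b + w) n) (hhi : hi = min (mid + w) n)
    (hw0 : 0 < w) (hbn : b < n)
    (hl : ∀ x y, b ≤ x → x ≤ y → y < mid → inp a (s.arr A x) ≤ inp a (s.arr A y))
    (hr : ∀ x y, mid ≤ x → x ≤ y → y < hi → inp a (s.arr A x) ≤ inp a (s.arr A y)) :
    Runs inp (mergeRuns a A) s (100 * (hi - b)) (fun s' => s'.var 4 = hi ∧
      (∀ x < b, s'.arr 2 x = s.arr 2 x) ∧
      (∀ x y, b ≤ x → x ≤ y → y < hi → inp a (s'.arr 2 x) ≤ inp a (s'.arr 2 y)) ∧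
      (∀ x, b ≤ x → x < hi → ∃ y, b ≤ y ∧ y < hi ∧ s'.arr 2 x = s.arr A y) ∧
      (∀ y, b ≤ y → y < hi → ∃ x, b ≤ x ∧ x < hi ∧ s'.arr 2 x = s.arr A y)) := by
  refine wp_seq (wp_assign (wp_seq (wp_assign (wp_seq (wp_assign (wp_seq (wp_assign ?_)))))))
  generalize hs₁ : State.setVar _ _ _ = s₁
  have h5 : s₁.var 5 = mid := by subst hs₁; simp [Expr.eval, hn, hw, hb]; omega
  have h6 : s₁.var 6 = hi := by subst hs₁; simp [Expr.eval, hn, hw, hb]; omega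
  have h4 : s₁.var 4 = b := by subst hs₁; simp [Expr.eval, hb]
  have h7 : s₁.var 7 = b := by subst hs₁; simp [Expr.eval, hb]
  have h8 : s₁.var 8 = mid := by rw [← h5]; subst hs₁; simp [Expr.eval]
  have harr : s₁.arr = s.arr := by subst hs₁; simp
  have hfr : (mergeStep a A).writesArr A = false := by simp [mergeStep, Program.writesArr, hA]
  refine wp_loop (MergeInv (inp a) (s.arr A) (s.arr 2) b mid hi) (fun s' => 50 * (hi - s'.var 4))
    ?_ (fun s' hF hI hlt => ?_) (fun s' t' hF hI hlt ht' => ?_)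
  · constructor <;> first | omega | (rw [harr]; intros; rfl)
  · simp only [Test.Holds, Expr.eval, hF.var 6 rfl, h6] at hlt
    have hA' : s'.arr A = s.arr A := by rw [hF.arr A hfr, harr]
    refine (mergeStep_spec (B := s.arr 2) ((hF.var 5 rfl).trans h5) ((hF.var 6 rfl).trans h6) hlt
      (by rwa [hA']) (by rwa [hA']) (by rwa [hA'])).wp fun s'' t'' hF' hI' ht'' => ?_
    rw [hA'] at hI'
    refine ⟨hI'.1, ?_⟩
    simp only [Test.cost, Expr.cost, hI'.2]
    omega
  · simp only [Test.Holds, Expr.eval, hF.var 6 rfl, h6] at hlt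
    obtain ⟨g1, g2, g3, g4, g5, g6, g7, g8, g9, g10, g11, g12⟩ := hI
    have h4' : s'.var 4 = hi := by omega
    rw [h4'] at g7 g10 g11 g12
    refine ⟨⟨h4', g6, g7, g10, fun y hy hy' => ?_⟩, ?_⟩
    · rcases lt_or_ge y mid with h | h
      · exact g11 y hy (by omega)
      · exact g12 y h (by omega)
    -- Merging costs at most 50 per entry; the other 50 pay for the setup, as the block is nonempty.
    · simp only [Expr.cost, Test.cost, h4] at ht'
      omega

theorem fill_spec {dst : ℕ} {e : Expr} {n : ℕ} {s : State} (hn : s.var 0 = n) (g : ℕ → ℕ)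
    (he : ∀ s', Frame (fill dst e) s s' → s'.var 4 < n → e.eval s' = g (s'.var 4)) :
    Runs inp (fill dst e) s ((e.cost + 10) * n + 10) (fun s' => ∀ i < n, s'.arr dst i = g i) := by
  refine wp_seq (wp_assign ?_)
  refine wp_loop (fun s' => s'.var 4 ≤ n ∧ ∀ i < s'.var 4, s'.arr dst i = g i)
    (fun s' => (e.cost + 10) * (n - s'.var 4)) ?_ (fun s' hF hI hlt => ?_)
    (fun s' t' hF hI hlt ht' => ?_)
  · simp [Expr.eval]
  · have h0 : s'.var 0 = n := by rw [hF.var 0 rfl, ← hn]; simp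
    simp only [Test.Holds, Expr.eval, h0] at hlt
    have hF' : Frame (fill dst e) s s' := by
      refine ⟨fun x hx => ?_, fun x hx => ?_⟩
      · simp only [fill, Program.writesVar, Bool.false_or, Bool.or_self, beq_eq_false_iff_ne] at hx
        rw [hF.var x (by simpa [Program.writesVar] using hx)]
        simp [hx]
      · simp only [fill, Program.writesArr, Bool.false_or, Bool.or_false] at hx
        rw [hF.arr x (by simpa [Program.writesArr] using hx)]
        simp
    refine wp_seq (wp_store (wp_assign ?_))
    rw [he s' hF' hlt]
    refine ⟨⟨?_, fun i hi => ?_⟩, ?_⟩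
    · simp [Expr.eval]; omega
    · simp only [State.setVar_arr, State.setArr_arr, if_true, Function.update_apply, Expr.eval]
      simp only [State.setVar_var, if_true, Expr.eval, State.setArr_var] at hi
      split_ifs with h
      · rw [h]
      · exact hI.2 i (by omega)
    · obtain ⟨r, hr⟩ : ∃ r, n - s'.var 4 = r + 1 := ⟨n - s'.var 4 - 1, by omega⟩
      have hr' : n - (s'.var 4 + 1) = r := by omega
      simp [Expr.eval, Expr.cost, Test.cost, hr, hr', mul_add]
      omega
  · have h0 : s'.var 0 = n := by rw [hF.var 0 rfl, ← hn]; simp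
    simp only [Test.Holds, Expr.eval, h0] at hlt
    refine ⟨fun i hi => hI.2 i (by omega), ?_⟩
    simp [Expr.eval, Expr.cost, Test.cost] at ht'
    omega

/-- `A` lists the numbers below `n`, in such a way that the entries of `κ` increase on each of the
intervals `[0, w)`, `[w, 2 w)`, … -/
structure SortedRuns (κ : ℕ → ℝ) (n w : ℕ) (A : ℕ → ℕ) : Prop where
  sorted : ∀ c x y, c * w ≤ x → x ≤ y → y < (c + 1) * w → y < n → κ (A x) ≤ κ (A y)
  lt : ∀ x < n, A x < n
  surj : ∀ v < n, ∃ x < n, A x = v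

theorem mergePass_spec {a A : ℕ} (hA : A ≠ 2) {n w : ℕ} {s : State} (hn : s.var 0 = n)
    (hw : s.var 3 = w) (hw0 : 0 < w) (h : SortedRuns (inp a) n w (s.arr A)) :
    Runs inp (mergePass a A) s (150 * n + 50)
      (fun s' => SortedRuns (inp a) n (w + w) (s'.arr A)) := by
  have hfr : (mergeRuns a A).writesArr A = false := by
    simp [mergeRuns, mergeStep, Program.writesArr, hA]
  refine wp_seq (wp_assign (wp_seq ?_))
  refine wp_loop (fun s' => (∃ c, s'.var 4 = min (c * (w + w)) n) ∧
    (∀ c x y, c * (w + w) ≤ x → x ≤ y → y < (c + 1) * (w + w) → y < s'.var 4 →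
      inp a (s'.arr 2 x) ≤ inp a (s'.arr 2 y)) ∧
    (∀ x < s'.var 4, s'.arr 2 x < n) ∧
    (∀ y < s'.var 4, ∃ x < s'.var 4, s'.arr 2 x = s.arr A y))
    (fun s' => 110 * (n - s'.var 4)) ?_ (fun s' hF hI hlt => ?_) (fun s' t' hF hI hlt ht' => ?_)
  · exact ⟨⟨0, by simp [Expr.eval]⟩, by simp [Expr.eval]⟩
  · have h0 : s'.var 0 = n := by rw [hF.var 0 rfl, ← hn]; simp
    have h3 : s'.var 3 = w := by rw [hF.var 3 rfl, ← hw]; simp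
    have hA' : s'.arr A = s.arr A := by rw [hF.arr A hfr]; simp
    simp only [Test.Holds, Expr.eval, h0] at hlt
    obtain ⟨⟨c, hc⟩, hsort, hltn, hsurj⟩ := hI
    have hcb : s'.var 4 = c * (w + w) := by omega
    -- Block `c` of length `2 w` consists of the runs `2 c` and `2 c + 1` of length `w`.
    have e1 : (c + 1) * (w + w) = c * (w + w) + w + w := by ring
    have e2 : 2 * c * w = c * (w + w) := by ring
    have e3 : (2 * c + 1) * w = c * (w + w) + w := by ring
    have e4 : (2 * c + 1 + 1) * w = c * (w + w) + w + w := by ring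
    generalize hb : s'.var 4 = b at *
    refine (mergeRuns_spec hA h0 h3 hb rfl rfl hw0 hlt ?_ ?_).wp fun s'' t'' hF' hI' ht'' => ?_
    · intro x y hx hxy hy
      rw [hA']
      exact h.sorted (2 * c) x y (by omega) hxy (by omega) (by omega)
    · intro x y hx hxy hy
      rw [hA']
      exact h.sorted (2 * c + 1) x y (by omega) hxy (by omega) (by omega)
    · obtain ⟨g1, g2, g3, g4, g5⟩ := hI'
      rw [g1]
      generalize hhi : min (min (b + w) n + w) n = hi at *
      rw [hA'] at g4 g5
      refine ⟨⟨⟨c + 1, by omega⟩, fun d x y hx hxy hy hy' => ?_, fun x hx => ?_, fun y hy => ?_⟩, ?_⟩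
      · rcases lt_or_ge y b with hyb | hyb
        · rw [g2 x (by omega), g2 y hyb]
          exact hsort d x y hx hxy hy hyb
        · refine g3 x y ?_ hxy hy'
          -- Since `b` is a block boundary, a block containing some `y ≥ b` lies entirely at or
          -- above `b`, so `x` is in the part just merged.
          have : c < d + 1 := by
            by_contra hcd
            have := Nat.mul_le_mul_right (w + w) (not_lt.1 hcd)
            omega
          have := Nat.mul_le_mul_right (w + w) (Nat.lt_succ_iff.1 this)
          omega
      · rcases lt_or_ge x b with hxb | hxb
        · rw [g2 x hxb]; exact hltn x hxb
        · obtain ⟨y, _, hy, e⟩ := g4 x hxb hx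
          rw [e]; exact h.lt y (by omega)
      · rcases lt_or_ge y b with hyb | hyb
        · obtain ⟨x, hx, e⟩ := hsurj y hyb
          exact ⟨x, by omega, by rw [g2 x hx, e]⟩
        · obtain ⟨x, _, hx, e⟩ := g5 y hyb hy
          exact ⟨x, hx, e⟩
      · simp only [Test.cost, Expr.cost]
        omega
  · have h0 : s'.var 0 = n := by rw [hF.var 0 rfl, ← hn]; simp
    simp only [Test.Holds, Expr.eval, h0] at hlt
    obtain ⟨⟨c, hc⟩, hsort, hltn, hsurj⟩ := hI
    have h4 : s'.var 4 = n := by omega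
    rw [h4] at hsort hltn hsurj
    refine (fill_spec h0 (s'.arr 2) fun s'' hF' _ => ?_).wp fun s'' t'' hF' hI' ht'' => ?_
    · have : s''.arr 2 = s'.arr 2 := hF'.arr 2 (by simp [fill, Program.writesArr, hA.symm])
      simp [Expr.eval, this]
    · refine ⟨⟨fun d x y hx hxy hy hy' => ?_, fun x hx => ?_, fun v hv => ?_⟩, ?_⟩
      · rw [hI' x (by omega), hI' y hy']
        exact hsort d x y hx hxy hy hy'
      · rw [hI' x hx]; exact hltn x hx
      · obtain ⟨y, hy, rfl⟩ := h.surj v hv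
        obtain ⟨x, hx, e⟩ := hsurj y hy
        exact ⟨x, hx, by rw [hI' x hx, e]⟩
      · simp [Expr.eval, Expr.cost, Test.cost] at ht' ht''
        omega

/-- `A` lists the numbers below `n` in the order of increasing `κ`. -/
structure IsSorting (κ : ℕ → ℝ) (n : ℕ) (A : ℕ → ℕ) : Prop where
  sorted : ∀ x y, x ≤ y → y < n → κ (A x) ≤ κ (A y)
  lt : ∀ x < n, A x < n
  surj : ∀ v < n, ∃ x < n, A x = v

theorem mergeSort_spec {a A : ℕ} (hA : A ≠ 2) {n : ℕ} {s : State} (hn : s.var 0 = n) :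
    Runs inp (mergeSort a A) s ((150 * n + 100) * (Nat.clog 2 n + 1))
      (fun s' => IsSorting (inp a) n (s'.arr A)) := by
  have hfr : (fill A (.get 2 (.var 4))).writesVar 3 = false := rfl
  refine wp_seq ((fill_spec hn id fun s' hF _ => rfl).wp fun s₁ t₁ hF₁ hI₁ ht₁ => ?_)
  refine wp_seq (wp_assign ?_)
  refine wp_loop (fun s' => ∃ e, s'.var 3 = 2 ^ e ∧ SortedRuns (inp a) n (s'.var 3) (s'.arr A))
    -- The run length is `2 ^ e`, so the second factor counts the passes still to be made.
    (fun s' => (150 * n + 80) * (Nat.clog 2 n - Nat.log 2 (s'.var 3))) ?_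
    (fun s' hF hI hlt => ?_) (fun s' t' hF hI hlt ht' => ?_)
  · refine ⟨0, by simp [Expr.eval], ?_⟩
    simp only [Expr.eval, State.setVar_arr, State.setVar_var, if_true]
    refine ⟨fun c x y hx hxy hy hy' => ?_, fun x hx => ?_, fun v hv => ⟨v, hv, hI₁ v hv⟩⟩
    · obtain rfl : x = y := by omega
      exact le_rfl
    · rw [hI₁ x hx]; exact hx
  · have h0 : s'.var 0 = n := by rw [hF.var 0 rfl, ← hn]; simp [hF₁.var 0 rfl]
    simp only [Test.Holds, Expr.eval, h0] at hlt
    obtain ⟨e, he, hI⟩ := hI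
    refine wp_seq ((mergePass_spec hA h0 rfl (by rw [he]; positivity) hI).wp
      fun s'' t'' hF' hI' ht'' => wp_assign ?_)
    have h3 : s''.var 3 = s'.var 3 := hF'.var 3 rfl
    have hpow : s'.var 3 + s'.var 3 = 2 ^ (e + 1) := by rw [he]; ring
    refine ⟨⟨e + 1, ?_, ?_⟩, ?_⟩
    · simp [Expr.eval, h3, hpow]
    · simpa [Expr.eval, h3] using hI'
    · have hlog : e < Nat.clog 2 n := by
        rw [Nat.lt_clog_iff_pow_lt (by norm_num)]
        omega
      obtain ⟨r, hr⟩ : ∃ r, Nat.clog 2 n = e + 1 + r := ⟨Nat.clog 2 n - (e + 1), by omega⟩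
      simp only [Expr.eval, Expr.cost, Test.cost, State.setVar_var, if_true, h3, he, ← two_mul,
        ← pow_succ',
        Nat.log_pow (le_refl 2), hr]
      have e1 : e + 1 + r - (e + 1) = r := by omega
      have e2 : e + 1 + r - e = r + 1 := by omega
      rw [e1, e2, mul_add]
      omega
  · have h0 : s'.var 0 = n := by rw [hF.var 0 rfl, ← hn]; simp [hF₁.var 0 rfl]
    simp only [Test.Holds, Expr.eval, h0] at hlt
    obtain ⟨e, he, hI⟩ := hI
    refine ⟨⟨fun x y hxy hy => hI.sorted 0 x y (by simp) hxy (by omega) hy, hI.lt, hI.surj⟩, ?_⟩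
    simp [Expr.eval, Expr.cost, Test.cost] at ht' ht₁
    nlinarith

end RAM

/-! ### Powers of `f + 1` and predecessor counts -/

namespace RAM

/-- `var 9 := (f + 1) ^ k`, `var 10 := k * f`, and array `5` receives the powers of `f + 1`. -/
def powers : Program :=
  .seq (.assign 9 (.num 1))
  (.seq (.assign 10 (.num 0))
  (.seq (.assign 11 (.num 0))
  (.loop (.lt (.var 11) (.var 1))
    (.seq (.store 5 (.var 11) (.var 9))
    (.seq (.assign 10 (.add (.var 10) (.var 2)))
    (.seq (.assign 13 (.var 9))
    (.seq (.assign 12 (.num 0))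
    -- Multiplication by `f + 1`, as `f` additions to a copy.
    (.seq (.loop (.lt (.var 12) (.var 2))
      (.seq (.assign 13 (.add (.var 13) (.var 9))) (.assign 12 (.add (.var 12) (.num 1)))))
    (.seq (.assign 9 (.var 13)) (.assign 11 (.add (.var 11) (.num 1))))))))))))

/-- Array `3` lists the vertices by left endpoints and array `4` by right endpoints. For every vertex
`v`, array `6` receives the number of the vertices with right endpoint smaller than the left
endpoint of `v`, and array `7` receives this number times `var 9`. -/
def predecessors : Program :=
  .seq (.assign 14 (.num 0))
  (.seq (.assign 15 (.num 0))
  (.seq (.assign 16 (.num 0))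
  (.loop (.lt (.var 16) (.var 0))
    (.branch (.and (.lt (.var 14) (.var 0))
        (.not (.realLe 0 (.get 3 (.var 16)) 1 (.get 4 (.var 14)))))
      (.seq (.assign 14 (.add (.var 14) (.num 1))) (.assign 15 (.add (.var 15) (.var 9))))
      (.seq (.store 6 (.get 3 (.var 16)) (.var 14))
      (.seq (.store 7 (.get 3 (.var 16)) (.var 15))
        (.assign 16 (.add (.var 16) (.num 1)))))))))

variable {inp : ℕ → ℕ → ℝ}

theorem powers_spec {k f : ℕ} {s : State} (hk : s.var 1 = k) (hf : s.var 2 = f) :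
    Runs inp powers s (50 * (k * (f + 1)) + 20) (fun s' => s'.var 9 = (f + 1) ^ k ∧
      s'.var 10 = k * f ∧ ∀ c < k, s'.arr 5 c = (f + 1) ^ c) := by
  refine wp_seq (wp_assign (wp_seq (wp_assign (wp_seq (wp_assign ?_)))))
  refine wp_loop (fun s' => s'.var 11 ≤ k ∧ s'.var 9 = (f + 1) ^ s'.var 11 ∧
    s'.var 10 = s'.var 11 * f ∧ ∀ c < s'.var 11, s'.arr 5 c = (f + 1) ^ c)
    (fun s' => (50 * (f + 1)) * (k - s'.var 11)) ?_
    (fun s' hF hI hlt => ?_) (fun s' t' hF hI hlt ht' => ?_)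
  · simp [Expr.eval]
  · have h1 : s'.var 1 = k := by rw [hF.var 1 rfl, ← hk]; simp
    have h2 : s'.var 2 = f := by rw [hF.var 2 rfl, ← hf]; simp
    simp only [Test.Holds, Expr.eval, h1] at hlt
    obtain ⟨-, h9, h10, h5⟩ := hI
    refine wp_seq (wp_store (wp_seq (wp_assign (wp_seq (wp_assign (wp_seq (wp_assign
      (wp_seq ?_))))))))
    refine wp_loop (fun u => u.var 12 ≤ f ∧ u.var 13 = (f + 1) ^ s'.var 11 * (u.var 12 + 1))
      (fun u => 15 * (f - u.var 12)) ?_ (fun u hG hJ hlt' => ?_) (fun u t' hG hJ hlt' ht' => ?_)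
    · simp [Expr.eval, h9]
    · have g2 : u.var 2 = f := by rw [hG.var 2 rfl, ← h2]; simp
      have g9 : u.var 9 = (f + 1) ^ s'.var 11 := by rw [hG.var 9 rfl, ← h9]; simp
      simp only [Test.Holds, Expr.eval, g2] at hlt'
      refine wp_seq (wp_assign (wp_assign ⟨⟨?_, ?_⟩, ?_⟩))
      · simp [Expr.eval]; omega
      · simp [Expr.eval, hJ.2, g9]; ring
      · simp [Expr.eval, Expr.cost, Test.cost]; omega
    · have g2 : u.var 2 = f := by rw [hG.var 2 rfl, ← h2]; simp
      have g10 : u.var 10 = s'.var 11 * f + f := by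
        rw [hG.var 10 rfl, ← h10, ← h2]; simp [Expr.eval]
      have g11 : u.var 11 = s'.var 11 := by rw [hG.var 11 rfl]; simp
      have ga : u.arr 5 = Function.update (s'.arr 5) (s'.var 11) ((f + 1) ^ s'.var 11) := by
        rw [hG.arr 5 rfl, ← h9]; simp [Expr.eval]
      simp only [Test.Holds, Expr.eval, g2] at hlt'
      have g12 : u.var 12 = f := by omega
      refine wp_seq (wp_assign (wp_assign ⟨⟨?_, ?_, ?_, ?_⟩, ?_⟩))
      · simp [Expr.eval, g11]; omega
      · simp [Expr.eval, g11, hJ.2, g12, pow_succ]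
      · simp [Expr.eval, g11, g10]; ring
      · intro c hc
        simp only [Expr.eval, State.setVar_var, if_true, g11] at hc
        simp only [State.setVar_arr, ga, Function.update_apply]
        split_ifs with h
        · rw [h]
        · refine h5 c ?_
          simp at hc; omega
      · obtain ⟨r, hr⟩ : ∃ r, k - s'.var 11 = r + 1 := ⟨k - s'.var 11 - 1, by omega⟩
        have hr' : k - (s'.var 11 + 1) = r := by omega
        simp [Expr.eval, Expr.cost, Test.cost] at ht'
        simp [Expr.eval, Expr.cost, Test.cost, g11, hr, hr', mul_add]
        omega
  · have h1 : s'.var 1 = k := by rw [hF.var 1 rfl, ← hk]; simp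
    simp only [Test.Holds, Expr.eval, h1] at hlt
    obtain ⟨h11, h9, h10, h5⟩ := hI
    have h11 : s'.var 11 = k := by omega
    rw [h11] at h9 h10 h5
    refine ⟨⟨h9, h10, h5⟩, ?_⟩
    simp [Expr.eval, Expr.cost, Test.cost] at ht'
    linarith

/-- `p v` is the number of the indices `j < n` with `ρ (A j) < lam v`. -/
def IsPred (lam ρ : ℕ → ℝ) (n : ℕ) (A : ℕ → ℕ) (v p : ℕ) : Prop :=
  p ≤ n ∧ ∀ j < n, j < p ↔ ρ (A j) < lam v

theorem predecessors_spec {n M : ℕ} {s : State} (hn : s.var 0 = n) (hM : s.var 9 = M)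
    (h3 : IsSorting (inp 0) n (s.arr 3)) (h4 : IsSorting (inp 1) n (s.arr 4)) :
    Runs inp predecessors s (60 * n + 20) (fun s' => ∀ v < n,
      IsPred (inp 0) (inp 1) n (s.arr 4) v (s'.arr 6 v) ∧ s'.arr 7 v = s'.arr 6 v * M) := by
  refine wp_seq (wp_assign (wp_seq (wp_assign (wp_seq (wp_assign ?_)))))
  -- A sweep with two pointers that only advance, hence linear time. The right endpoints already
  -- counted lie below every left endpoint still to come.
  refine wp_loop (fun s' => s'.var 14 ≤ n ∧ s'.var 16 ≤ n ∧ s'.var 15 = s'.var 14 * M ∧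
      (∀ j < s'.var 14, ∀ y, s'.var 16 ≤ y → y < n → inp 1 (s.arr 4 j) < inp 0 (s.arr 3 y)) ∧
      ∀ y < s'.var 16, IsPred (inp 0) (inp 1) n (s.arr 4) (s.arr 3 y) (s'.arr 6 (s.arr 3 y)) ∧
        s'.arr 7 (s.arr 3 y) = s'.arr 6 (s.arr 3 y) * M)
    (fun s' => 30 * ((n - s'.var 14) + (n - s'.var 16))) ?_
    (fun s' hF hI hlt => ?_) (fun s' t' hF hI hlt ht' => ?_)
  · simp [Expr.eval]
  · have h0 : s'.var 0 = n := by rw [hF.var 0 rfl, ← hn]; simp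
    have h9 : s'.var 9 = M := by rw [hF.var 9 rfl, ← hM]; simp
    have a3 : s'.arr 3 = s.arr 3 := by rw [hF.arr 3 rfl]; simp
    have a4 : s'.arr 4 = s.arr 4 := by rw [hF.arr 4 rfl]; simp
    simp only [Test.Holds, Expr.eval, h0] at hlt
    obtain ⟨h14, h16, h15, hlow, hdone⟩ := hI
    refine wp_branch (fun hb => ?_) fun hb => ?_
    · simp only [Test.Holds, Expr.eval, h0, a3, a4, not_le] at hb
      refine wp_seq (wp_assign (wp_assign ⟨⟨?_, ?_, ?_, ?_, ?_⟩, ?_⟩))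
      · simp [Expr.eval]; omega
      · simpa [Expr.eval]
      · simp [Expr.eval, h15, h9]; ring
      · intro j hj y hy hyn
        simp [Expr.eval] at hj hy
        rcases Nat.lt_or_eq_of_le hj with hj | rfl
        · exact hlow j hj y hy hyn
        · exact hb.2.trans_le (h3.sorted _ _ hy hyn)
      · simpa [Expr.eval] using hdone
      · simp [Expr.eval, Expr.cost, Test.cost]; omega
    · simp only [Test.Holds, Expr.eval, h0, a3, a4, not_and, not_not] at hb
      refine wp_seq (wp_store (wp_seq (wp_store (wp_assign ⟨⟨?_, ?_, ?_, ?_, ?_⟩, ?_⟩))))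
      · simpa [Expr.eval]
      · simp [Expr.eval]; omega
      · simpa [Expr.eval]
      · intro j hj y hy hyn
        simp [Expr.eval] at hj hy
        exact hlow j hj y (by omega) hyn
      · intro y hy
        simp [Expr.eval] at hy
        simp [Expr.eval, a3, Function.update_apply]
        split_ifs with h
        · rw [h, h15]
          refine ⟨⟨h14, fun j hj => ⟨fun hj' => hlow j hj' _ le_rfl hlt, fun hj' => ?_⟩⟩, rfl⟩
          by_contra hj''
          -- The first uncounted right endpoint is not below the current left endpoint, and later
          -- ones are no smaller.
          have := (hb (by omega)).trans (h4.sorted _ j (by omega) hj)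
          exact absurd hj' (not_lt.2 this)
        · have : y ≠ s'.var 16 := fun e => h (by rw [e])
          exact hdone y (by omega)
      · simp [Expr.eval, Expr.cost, Test.cost]; omega
  · have h0 : s'.var 0 = n := by rw [hF.var 0 rfl, ← hn]; simp
    simp only [Test.Holds, Expr.eval, h0] at hlt
    obtain ⟨h14, h16, h15, hlow, hdone⟩ := hI
    refine ⟨fun v hv => ?_, ?_⟩
    · obtain ⟨y, hy, rfl⟩ := h3.surj v hv
      exact hdone y (by omega)
    · simp [Expr.eval, Expr.cost, Test.cost] at ht'
      omega

end RAM

/-! ### Color counts as digits in base `f + 1` -/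

/-- Induction on the number of digits, generalized by an incoming carry `r`. Modulo `f + 1` the
lowest position satisfies `r + x 0 = f + (f + 1) * q`, and `q` is carried on; the total `r + ∑ c, x
c` thus exceeds the bound from the induction hypothesis by `f + f * q`. -/
theorem eq_of_add_sum_mul_pow {f k : ℕ} : ∀ (r : ℕ) (x : Fin k → ℕ),
    r + ∑ c, x c * (f + 1) ^ (c : ℕ) + 1 = (f + 1) ^ k →
    k * f ≤ r + ∑ c, x c ∧ (r + ∑ c, x c ≤ k * f → r = 0 → ∀ c, x c = f) := by
  induction k with
  | zero => intro r x _; exact ⟨by simp, fun _ _ c => c.elim0⟩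
  | succ k ih =>
    intro r x hx
    have hs : ∑ c : Fin k, x c.succ * (f + 1) ^ ((c.succ : Fin (k + 1)) : ℕ) =
        (f + 1) * ∑ c : Fin k, x c.succ * (f + 1) ^ (c : ℕ) := by
      rw [Finset.mul_sum]
      refine Finset.sum_congr rfl fun c _ => ?_
      rw [Fin.val_succ]; ring
    rw [Fin.sum_univ_succ, hs] at hx
    simp only [Fin.val_zero, pow_zero, mul_one] at hx
    generalize hW : ∑ c : Fin k, x c.succ * (f + 1) ^ (c : ℕ) = W at hx
    obtain ⟨q, hq⟩ : ∃ q, r + x 0 = f + (f + 1) * q := by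
      have h1 : (f + 1) ∣ r + x 0 + 1 := by
        rw [← Nat.dvd_add_left (Dvd.intro W rfl : (f + 1) ∣ (f + 1) * W)]
        exact ⟨(f + 1) ^ k, by rw [← pow_succ', ← hx]; ring⟩
      obtain ⟨q, hq⟩ := h1
      cases q with
      | zero => omega
      | succ q => exact ⟨q, by rw [mul_add] at hq; omega⟩
    obtain ⟨h1, h2⟩ := ih q (fun c => x c.succ) (by
      rw [hW]
      have : (f + 1) * (q + W + 1) = (f + 1) * (f + 1) ^ k := by
        rw [← pow_succ', ← hx]; linarith
      exact Nat.eq_of_mul_eq_mul_left (Nat.succ_pos f) this)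
    have e1 : (f + 1) * q = f * q + q := by ring
    have e2 : (k + 1) * f = k * f + f := by ring
    rw [Fin.sum_univ_succ]
    refine ⟨by omega, fun hle hr => ?_⟩
    -- Equality leaves no room for the excess `f * q`: either `f = 0`, and all digits vanish, or
    -- nothing is carried.
    have hfq : f * q = 0 := by omega
    rcases Nat.mul_eq_zero.1 hfq with rfl | rfl
    · rw [← Fin.sum_univ_succ] at hle
      intro c
      have := Finset.single_le_sum (f := x) (fun _ _ => Nat.zero_le _) (Finset.mem_univ c)
      omega
    · exact Fin.cases (by omega) (h2 (by omega) rfl)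

/-- If the number `(f + 1) ^ k - 1` is a sum of powers `(f + 1) ^ c`, `c < k`, with at most `k * f`
summands, then every power is used exactly `f` times. -/
theorem eq_of_sum_mul_pow {f k : ℕ} {x : Fin k → ℕ}
    (h : ∑ c, x c * (f + 1) ^ (c : ℕ) + 1 = (f + 1) ^ k) (hle : ∑ c, x c ≤ k * f) (c : Fin k) :
    x c = f :=
  (eq_of_add_sum_mul_pow 0 x (by rwa [zero_add])).2 (by rwa [zero_add]) rfl c

theorem sum_mul_pow_add_one (f k : ℕ) : ∑ c : Fin k, f * (f + 1) ^ (c : ℕ) + 1 = (f + 1) ^ k := by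
  induction k with
  | zero => simp
  | succ k ih =>
    rw [Fin.sum_univ_castSucc]
    simp only [Fin.val_castSucc, Fin.val_last]
    rw [pow_succ, ← ih]; ring

theorem sum_pow_color {n k : ℕ} (B : ℕ) (γ : Fin n → Fin k) (S : Finset (Fin n)) :
    ∑ v ∈ S, B ^ (γ v : ℕ) = ∑ c, (S.filter fun v => γ v = c).card * B ^ (c : ℕ) := by
  rw [← Finset.sum_fiberwise S γ]
  refine Finset.sum_congr rfl fun c _ => ?_
  rw [Finset.sum_congr rfl (g := fun _ => B ^ (c : ℕ)) fun v hv => by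
    rw [(Finset.mem_filter.1 hv).2]]
  simp

/-- The cardinality bound is indispensable: weight alone also admits sets in which `f + 1` elements
of one color replace one of the next. -/
theorem balanced_iff {n k f : ℕ} (γ : Fin n → Fin k) (S : Finset (Fin n)) :
    (∀ c, (S.filter fun v => γ v = c).card = f) ↔
      ∑ v ∈ S, (f + 1) ^ (γ v : ℕ) + 1 = (f + 1) ^ k ∧ S.card ≤ k * f := by
  have hcard : S.card = ∑ c, (S.filter fun v => γ v = c).card :=
    Finset.card_eq_sum_card_fiberwise fun _ _ => Finset.mem_univ _
  rw [sum_pow_color, hcard]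
  refine ⟨fun h => ?_, fun h => eq_of_sum_mul_pow h.1 h.2⟩
  simp only [h, sum_mul_pow_add_one]
  simp

/-! ### Separated sets and the recursion for their least size -/

/-- The vertices of `S` have pairwise disjoint intervals `[lam v, ρ v]`. -/
def Separated {n : ℕ} (lam ρ : ℕ → ℝ) (S : Finset (Fin n)) : Prop :=
  ∀ u ∈ S, ∀ v ∈ S, u ≠ v → ρ u < lam v ∨ ρ v < lam u

theorem IntervalRep.isIndepSet_iff {n : ℕ} {G : SimpleGraph (Fin n)} (R : IntervalRep G)
    (S : Finset (Fin n)) :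
    G.IsIndepSet (S : Set (Fin n)) ↔ Separated (R.inputReals 0) (R.inputReals 1) S := by
  have key : ∀ u v, u ≠ v → (¬ G.Adj u v ↔ R.right u < R.left v ∨ R.right v < R.left u) := by
    intro u v huv
    have hu := R.left_le_right u
    have hv := R.left_le_right v
    rw [R.adj_iff u v huv, Set.Icc_inter_Icc, Set.nonempty_Icc]
    simp only [sup_le_iff, le_inf_iff, not_and_or, not_le]
    constructor
    · rintro ((h | h) | (h | h))
      · exact absurd hu (not_le.2 h)
      · exact .inl h
      · exact .inr h
      · exact absurd hv (not_le.2 h)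
    · rintro (h | h)
      · exact .inl (.inr h)
      · exact .inr (.inl h)
  have hl : ∀ v : Fin n, R.inputReals 0 v = R.left v := fun v => by
    simp [IntervalRep.inputReals]
  have hr : ∀ v : Fin n, R.inputReals 1 v = R.right v := fun v => by
    simp [IntervalRep.inputReals]
  simp only [SimpleGraph.IsIndepSet, Set.Pairwise, Separated, Finset.mem_coe, hl, hr]
  exact ⟨fun h u hu v hv huv => (key u v huv).1 (h hu hv huv),
    fun h u hu v hv huv => (key u v huv).2 (h u hu v hv huv)⟩

/-- The recursion of the dynamic program: `minSize K ord p wt i m` is the least number of elements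
of an independent set of weight `m` among the first `i` vertices of the list `ord`, and more than
`K` when there is no such set. -/
def minSize (K : ℕ) (ord p wt : ℕ → ℕ) : ℕ → ℕ → ℕ
  -- `K + 1` serves as infinity; it can only grow further along the recursion.
  | 0, m => if m = 0 then 0 else K + 1
  | i + 1, m =>
    -- The `min` with `i` serves termination only (see `IsPred.le_index`). As the inequality is
    -- strict, the value changes from `i` to `i + 1` exactly when `ord i` is taken.
    if wt (ord i) ≤ m ∧
        minSize K ord p wt (min (p (ord i)) i) (m - wt (ord i)) + 1 < minSize K ord p wt i m then
      minSize K ord p wt (min (p (ord i)) i) (m - wt (ord i)) + 1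
    else minSize K ord p wt i m
  termination_by i => i
  decreasing_by all_goals omega

section

variable {n K : ℕ} {lam ρ : ℕ → ℝ} {ord p wt : ℕ → ℕ}

/-- An interval does not end before it starts, so a vertex is not among its own predecessors. -/
theorem IsPred.le_index {v i : ℕ} (h : RAM.IsPred lam ρ n ord v (p v)) (hi : i < n)
    (hv : ord i = v) (hle : lam v ≤ ρ v) : p v ≤ i := by
  by_contra hlt
  have := (h.2 i hi).1 (not_le.1 hlt)
  rw [hv] at this
  exact absurd hle (not_le.2 this)

/-- Induction on `i`, according to whether `S` contains the last vertex `ord i`. If it does, the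
rest of `S` lies to the left of it, hence among the first `p (ord i)` vertices, and the recursion
has considered that case. -/
theorem minSize_le_card (hord : RAM.IsSorting ρ n ord) (hle : ∀ v < n, lam v ≤ ρ v)
    (hp : ∀ v < n, RAM.IsPred lam ρ n ord v (p v)) : ∀ i ≤ n, ∀ S : Finset (Fin n),
    Separated lam ρ S → (∀ v ∈ S, ∃ j < i, ord j = v) →
    minSize K ord p wt i (∑ v ∈ S, wt v) ≤ S.card := by
  intro i
  induction i using Nat.strong_induction_on with
  | _ i ih =>
    intro hi S hS hmem
    cases i with
    | zero =>
      obtain rfl : S = ∅ := Finset.eq_empty_of_forall_notMem fun v hv => by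
        obtain ⟨j, hj, -⟩ := hmem v hv
        omega
      simp [minSize]
    | succ i =>
      have hv := hord.lt i (by omega)
      have hpi := IsPred.le_index (hp _ hv) (by omega) rfl (hle _ hv)
      rw [minSize, min_eq_left hpi]
      by_cases hvS : (⟨ord i, hv⟩ : Fin n) ∈ S
      · have h1 := ih (p (ord i)) (by omega) (by omega) (S.erase ⟨ord i, hv⟩)
          (fun u hu v hv huv => hS u (Finset.mem_of_mem_erase hu) v (Finset.mem_of_mem_erase hv) huv)
          fun u hu => by
            obtain ⟨j, hj, hju⟩ := hmem u (Finset.mem_of_mem_erase hu)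
            have hne := Finset.ne_of_mem_erase hu
            have hji : j ≠ i := by
              rintro rfl
              exact hne (Fin.ext hju.symm)
            refine ⟨j, ((hp _ hv).2 j (by omega)).2 ?_, hju⟩
            -- The vertex `u` cannot lie to the right of `ord i`, because it comes earlier in the
            -- order of right endpoints.
            rcases hS u (Finset.mem_of_mem_erase hu) _ hvS hne with h | h
            · rwa [hju]
            · have h2 := hord.sorted j i (by omega) (by omega)
              rw [hju] at h2
              exact absurd (hle u u.2) (not_le.2 (h2.trans_lt h))
        have h2 := Finset.add_sum_erase S (fun v : Fin n => wt v) hvS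
        have h3 := Finset.card_erase_add_one hvS
        simp only at h2
        have h4 : ∑ v ∈ S, wt v - wt (ord i) = ∑ v ∈ S.erase ⟨ord i, hv⟩, wt v := by omega
        rw [h4]
        split_ifs <;> omega
      · have h1 := ih i (by omega) (by omega) S hS fun u hu => by
          obtain ⟨j, hj, hju⟩ := hmem u hu
          refine ⟨j, ?_, hju⟩
          rcases Nat.lt_succ_iff_lt_or_eq.1 hj with hj | rfl
          · exact hj
          · exact absurd hu (by convert hvS; exact hju.symm)
        split_ifs <;> omega

/-- The invariant of the traceback: a set `X` has been collected, and it can be completed to a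
separated set of weight `m₀` with `d` elements by a set of weight `m` among the first `i`
vertices. -/
structure TraceInv (n K : ℕ) (lam ρ : ℕ → ℝ) (ord p wt : ℕ → ℕ) (m₀ d i m : ℕ)
    (X : Finset (Fin n)) : Prop where
  separated : Separated lam ρ X
  lt : ∀ x ∈ X, ∀ j < i, ρ (ord j) < lam x
  weight : ∑ v ∈ X, wt v + m = m₀
  card : X.card + minSize K ord p wt i m = d
  le : minSize K ord p wt i m ≤ K

variable {m₀ d i m : ℕ} {X : Finset (Fin n)}

theorem TraceInv.skip (h : TraceInv n K lam ρ ord p wt m₀ d (i + 1) m X)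
    (heq : minSize K ord p wt i m = minSize K ord p wt (i + 1) m) :
    TraceInv n K lam ρ ord p wt m₀ d i m X :=
  ⟨h.separated, fun x hx j hj => h.lt x hx j (by omega), h.weight, heq ▸ h.card, heq ▸ h.le⟩

/-- The changed value shows that the recursion took `ord i`. This vertex lies to the left of all of
`X`, and the first `p (ord i)` vertices lie to the left of it, so separation persists. -/
theorem TraceInv.take (hle : ∀ v < n, lam v ≤ ρ v)
    (hp : ∀ v < n, RAM.IsPred lam ρ n ord v (p v))
    (h : TraceInv n K lam ρ ord p wt m₀ d (i + 1) m X) (hi : i < n) (hv : ord i < n)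
    (hne : minSize K ord p wt i m ≠ minSize K ord p wt (i + 1) m) :
    TraceInv n K lam ρ ord p wt m₀ d (p (ord i)) (m - wt (ord i)) (insert ⟨ord i, hv⟩ X) := by
  have hpi := IsPred.le_index (hp _ hv) hi rfl (hle _ hv)
  obtain ⟨h1, h2, h3, h4, h5⟩ := h
  have hlt : ∀ x ∈ X, ρ (ord i) < lam x := fun x hx => h2 x hx i (by omega)
  have hnot : (⟨ord i, hv⟩ : Fin n) ∉ X := fun hx =>
    absurd (hle _ hv) (not_le.2 (hlt _ hx))
  rw [minSize, min_eq_left hpi] at h4 h5 hne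
  split_ifs at h4 h5 hne with hc
  · refine ⟨?_, ?_, ?_, ?_, by omega⟩
    · intro u hu w hw huw
      rcases Finset.mem_insert.1 hu with rfl | hu <;> rcases Finset.mem_insert.1 hw with rfl | hw
      · exact absurd rfl huw
      · exact .inl (hlt w hw)
      · exact .inr (hlt u hu)
      · exact h1 u hu w hw huw
    · intro x hx j hj
      rcases Finset.mem_insert.1 hx with rfl | hx
      · exact ((hp _ hv).2 j (by omega)).1 hj
      · exact h2 x hx j (by omega)
    · rw [Finset.sum_insert hnot]
      simp only
      omega
    · rw [Finset.card_insert_of_notMem hnot]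
      omega
  · exact absurd rfl hne

/-- The bound `K` excludes the infinite value `K + 1`, so no weight remains. -/
theorem TraceInv.zero (h : TraceInv n K lam ρ ord p wt m₀ d 0 m X) :
    Separated lam ρ X ∧ ∑ v ∈ X, wt v = m₀ ∧ X.card = d := by
  obtain ⟨h1, -, h3, h4, h5⟩ := h
  rw [minSize] at h4 h5
  split_ifs at h4 h5 with hm <;> exact ⟨h1, by omega, by omega⟩

end

/-! ### Computing the table and tracing back -/

namespace RAM

/-- Fills the table of the dynamic program: entry `i * var 9 + m` of array `8` is the value of
`minSize` at `i` and `m`. -/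
def table : Program :=
  .seq (.assign 19 (.num 0))
  (.seq (.loop (.lt (.var 19) (.var 9))
    (.seq (.store 8 (.var 19) (.add (.var 10) (.num 1))) (.assign 19 (.add (.var 19) (.num 1)))))
  (.seq (.store 8 (.num 0) (.num 0))
  (.seq (.assign 17 (.num 0))
  -- The flat position `i * M + m` of the current entry, with `M` in `var 9`. It is never reset,
  -- since the rows adjoin, and the entry below it is `M` further on.
  (.seq (.assign 18 (.num 0))
  (.loop (.lt (.var 17) (.var 0))
    (.seq (.assign 20 (.get 4 (.var 17)))
    (.seq (.assign 21 (.get 5 (.get 0 (.var 20))))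
    (.seq (.assign 22 (.get 7 (.var 20)))
    (.seq (.assign 19 (.num 0))
    (.seq (.loop (.lt (.var 19) (.var 9))
      (.seq (.branch (.and (.not (.lt (.var 19) (.var 21)))
          (.lt (.add (.get 8 (.add (.var 22) (.sub (.var 19) (.var 21)))) (.num 1))
            (.get 8 (.var 18))))
        (.store 8 (.add (.var 18) (.var 9))
          (.add (.get 8 (.add (.var 22) (.sub (.var 19) (.var 21)))) (.num 1)))
        (.store 8 (.add (.var 18) (.var 9)) (.get 8 (.var 18))))
      (.seq (.assign 19 (.add (.var 19) (.num 1))) (.assign 18 (.add (.var 18) (.num 1))))))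
    (.assign 17 (.add (.var 17) (.num 1)))))))))))))

/-- Marks in array `1` an optimal set for the table entry number `var 18 + var 19`, in row
`var 17`. -/
def traceback : Program :=
  .loop (.lt (.num 0) (.var 17))
    (.seq (.assign 17 (.sub (.var 17) (.num 1)))
    (.seq (.assign 18 (.sub (.var 18) (.var 9)))
    (.branch (.eq (.get 8 (.add (.var 18) (.var 19)))
        (.get 8 (.add (.add (.var 18) (.var 9)) (.var 19))))
      .skip
      (.seq (.assign 20 (.get 4 (.var 17)))
      (.seq (.store 1 (.var 20) (.num 1))
      (.seq (.assign 19 (.sub (.var 19) (.get 5 (.get 0 (.var 20)))))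
      (.seq (.assign 17 (.get 6 (.var 20))) (.assign 18 (.get 7 (.var 20))))))))))

variable {inp : ℕ → ℕ → ℝ}

theorem mul_add_inj {M r m r' m' : ℕ} (hm : m < M) (hm' : m' < M) (h : r * M + m = r' * M + m') :
    r = r' ∧ m = m' := by
  have hM : 0 < M := by omega
  have h1 : (r * M + m) / M = r := by
    rw [mul_comm, Nat.mul_add_div hM, Nat.div_eq_of_lt hm, add_zero]
  have h2 : (r' * M + m') / M = r' := by
    rw [mul_comm, Nat.mul_add_div hM, Nat.div_eq_of_lt hm', add_zero]
  have hr : r = r' := by rw [← h1, h, h2]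
  subst hr
  exact ⟨rfl, by omega⟩

theorem table_spec {n M K : ℕ} {s : State} {ord p wt : ℕ → ℕ} (hn : s.var 0 = n)
    (hM : s.var 9 = M) (hM0 : 0 < M) (hK : s.var 10 = K) (hord : s.arr 4 = ord)
    (hlt : ∀ i < n, ord i < n) (hwt : ∀ v < n, s.arr 5 (s.arr 0 v) = wt v)
    (hpM : ∀ v < n, s.arr 7 v = p v * M) (hp : ∀ i < n, p (ord i) ≤ i) :
    Runs inp table s (150 * (M * n) + 30 * M + 30) (fun s' => s'.var 17 = n ∧ s'.var 18 = n * M ∧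
      ∀ r ≤ n, ∀ m < M, s'.arr 8 (r * M + m) = minSize K ord p wt r m) := by
  refine wp_seq (wp_assign (wp_seq ?_))
  refine wp_loop (fun u => u.var 19 ≤ M ∧ ∀ m < u.var 19, u.arr 8 m = K + 1)
    (fun u => 20 * (M - u.var 19)) ?_ (fun u hF hI hb => ?_) (fun s₁ t₁ hF₁ hI₁ hb₁ ht₁ => ?_)
  · simp [Expr.eval]
  · have h9 : u.var 9 = M := by rw [hF.var 9 rfl, ← hM]; simp
    have h10 : u.var 10 = K := by rw [hF.var 10 rfl, ← hK]; simp
    simp only [Test.Holds, Expr.eval, h9] at hb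
    refine wp_seq (wp_store (wp_assign ⟨⟨?_, fun m hm => ?_⟩, ?_⟩))
    · simp [Expr.eval]; omega
    · simp [Expr.eval] at hm
      simp [Expr.eval, Function.update_apply, h10]
      intro h
      exact hI.2 m (by omega)
    · simp [Expr.eval, Expr.cost, Test.cost]; omega
  have h9 : s₁.var 9 = M := by rw [hF₁.var 9 rfl, ← hM]; simp
  simp only [Test.Holds, Expr.eval, h9] at hb₁
  refine wp_seq (wp_store (wp_seq (wp_assign (wp_seq (wp_assign ?_)))))
  refine wp_loop (fun u => u.var 17 ≤ n ∧ u.var 18 = u.var 17 * M ∧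
    ∀ r m, m < M → r * M + m < (u.var 17 + 1) * M → u.arr 8 (r * M + m) = minSize K ord p wt r m)
    (fun u => 150 * M * (n - u.var 17)) ?_ (fun u hF hI hb => ?_) (fun u t hF hI hb ht => ?_)
  · refine ⟨by simp [Expr.eval], by simp [Expr.eval], fun r m hm hr => ?_⟩
    simp [Expr.eval] at hr
    have hr0 : r = 0 := by
      by_contra h
      have := Nat.mul_le_mul_right M (Nat.one_le_iff_ne_zero.2 h)
      omega
    subst hr0
    rw [minSize]
    simp [Expr.eval, Function.update_apply]
    split_ifs with h
    · rfl
    · exact hI₁.2 m (by omega)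
  · have h0 : u.var 0 = n := by rw [hF.var 0 rfl, ← hn]; simp [hF₁.var 0 rfl]
    have h9' : u.var 9 = M := by rw [hF.var 9 rfl, ← h9]; simp
    have a4 : u.arr 4 = ord := by rw [hF.arr 4 rfl, ← hord]; simp [hF₁.arr 4 rfl]
    have a5 : u.arr 5 = s.arr 5 := by rw [hF.arr 5 rfl]; simp [hF₁.arr 5 rfl]
    have a0 : u.arr 0 = s.arr 0 := by rw [hF.arr 0 rfl]; simp [hF₁.arr 0 rfl]
    have a7 : u.arr 7 = s.arr 7 := by rw [hF.arr 7 rfl]; simp [hF₁.arr 7 rfl]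
    simp only [Test.Holds, Expr.eval, h0] at hb
    obtain ⟨-, h18, h8⟩ := hI
    generalize hi : u.var 17 = i at *
    have hv := hlt i hb
    have hpi := hp i hb
    refine wp_seq (wp_assign (wp_seq (wp_assign (wp_seq (wp_assign (wp_seq (wp_assign
      (wp_seq ?_))))))))
    generalize hu₁ : State.setVar _ _ _ = u₁
    have g9 : u₁.var 9 = M := by subst hu₁; simpa
    have g17 : u₁.var 17 = i := by subst hu₁; simpa
    have g18 : u₁.var 18 = i * M := by subst hu₁; simpa
    have g19 : u₁.var 19 = 0 := by subst hu₁; simp [Expr.eval]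
    have g21 : u₁.var 21 = wt (ord i) := by
      subst hu₁; simp [Expr.eval, a4, a5, a0, hi, hwt _ hv]
    have g22 : u₁.var 22 = p (ord i) * M := by
      subst hu₁; simp [Expr.eval, a4, a7, hi, hpM _ hv]
    have g8 : u₁.arr 8 = u.arr 8 := by subst hu₁; simp
    have hiM : (i + 1) * M = i * M + M := by ring
    have hpM' := Nat.mul_le_mul_right M hpi
    refine wp_loop (fun w => w.var 19 ≤ M ∧ w.var 18 = i * M + w.var 19 ∧
      ∀ r m, m < M → r * M + m < (i + 1) * M + w.var 19 →
        w.arr 8 (r * M + m) = minSize K ord p wt r m)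
      (fun w => 60 * (M - w.var 19)) ?_ (fun w hG hJ hb' => ?_) (fun w t hG hJ hb' ht => ?_)
    · rw [g19, g8, g18]
      exact ⟨Nat.zero_le _, rfl, h8⟩
    · have e9 : w.var 9 = M := (hG.var 9 rfl).trans g9
      have e21 : w.var 21 = wt (ord i) := (hG.var 21 rfl).trans g21
      have e22 : w.var 22 = p (ord i) * M := (hG.var 22 rfl).trans g22
      simp only [Test.Holds, Expr.eval, e9] at hb'
      obtain ⟨-, e18, e8⟩ := hJ
      generalize hm₀ : w.var 19 = m₀ at *
      have c1 : w.arr 8 (w.var 18) = minSize K ord p wt i m₀ := by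
        rw [e18]; exact e8 i m₀ hb' (by omega)
      -- This holds even if `wt (ord i) > m₀`: the truncated difference is then `0`, so the entry
      -- read is still one already filled.
      have c2 : w.arr 8 (w.var 22 + (m₀ - wt (ord i))) =
          minSize K ord p wt (p (ord i)) (m₀ - wt (ord i)) := by
        rw [e22]; exact e8 _ _ (by omega) (by omega)
      have hval : ∀ x, x = minSize K ord p wt (i + 1) m₀ → ∀ r m, m < M →
          r * M + m < (i + 1) * M + (m₀ + 1) →
          Function.update (w.arr 8) (w.var 18 + w.var 9) x (r * M + m) =
            minSize K ord p wt r m := by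
        intro x hx r m hm hr
        have e : w.var 18 + w.var 9 = (i + 1) * M + m₀ := by omega
        rw [e, Function.update_apply]
        split_ifs with h
        · obtain ⟨rfl, rfl⟩ := mul_add_inj hm hb' h
          exact hx
        · exact e8 r m hm (by omega)
      refine wp_seq (wp_branch (fun hc => ?_) fun hc => ?_) <;>
        refine wp_store (wp_seq (wp_assign (wp_assign ⟨⟨?_, ?_, ?_⟩, ?_⟩)))
      · simp [Expr.eval, hm₀]; omega
      · simp [Expr.eval, hm₀, e18]; omega
      · simp only [Test.Holds, Expr.eval, c1, c2, hm₀, e21, not_lt] at hc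
        simp only [Expr.eval, State.setVar_var, State.setVar_arr, State.setArr_arr,
          State.setArr_var, if_true, hm₀, e21]
        simp only [Nat.reduceEqDiff, if_false]
        refine hval _ ?_
        rw [c2, minSize, min_eq_left hpi, if_pos hc]
      · simp [Expr.eval, Expr.cost, Test.cost, hm₀]; omega
      · simp [Expr.eval, hm₀]; omega
      · simp [Expr.eval, hm₀, e18]; omega
      · simp only [Test.Holds, Expr.eval, c1, c2, hm₀, e21, not_lt] at hc
        simp only [Expr.eval, State.setVar_var, State.setVar_arr, State.setArr_arr,
          State.setArr_var, if_true, hm₀]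
        simp only [Nat.reduceEqDiff, if_false]
        refine hval _ ?_
        rw [c1, minSize, min_eq_left hpi, if_neg hc]
      · simp [Expr.eval, Expr.cost, Test.cost, hm₀]; omega
    · have e9 : w.var 9 = M := (hG.var 9 rfl).trans g9
      have e17 : w.var 17 = i := (hG.var 17 rfl).trans g17
      simp only [Test.Holds, Expr.eval, e9] at hb'
      obtain ⟨e19, e18, e8⟩ := hJ
      have e19 : w.var 19 = M := by omega
      rw [e19] at e18 e8
      refine wp_assign ⟨⟨?_, ?_, ?_⟩, ?_⟩
      · simp [Expr.eval, e17]; omega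
      · simp [Expr.eval, e17, e18, hiM]
      · intro r m hm hr
        simp [Expr.eval, e17] at hr ⊢
        refine e8 r m hm ?_
        have : (i + 1 + 1) * M = (i + 1) * M + M := by ring
        omega
      · obtain ⟨r, hr⟩ : ∃ r, n - i = r + 1 := ⟨n - i - 1, by omega⟩
        have hr' : n - (i + 1) = r := by omega
        simp [Expr.cost, Test.cost, g19] at ht
        simp [Expr.eval, Expr.cost, Test.cost, e17, hr, hr', mul_add]
        omega
  · have h0 : u.var 0 = n := by rw [hF.var 0 rfl, ← hn]; simp [hF₁.var 0 rfl]
    simp only [Test.Holds, Expr.eval, h0] at hb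
    obtain ⟨h17, h18, h8⟩ := hI
    have h17 : u.var 17 = n := by omega
    rw [h17] at h18 h8
    refine ⟨⟨h17, h18, fun r hr m hm => h8 r m hm ?_⟩, ?_⟩
    · have := Nat.mul_le_mul_right M hr
      have : (n + 1) * M = n * M + M := by ring
      omega
    · simp [Expr.eval, Expr.cost, Test.cost] at ht₁ ht
      have : 150 * M * n = 150 * (M * n) := by ring
      omega

theorem traceback_spec {n M K m₀ : ℕ} {s : State} {lam ρ : ℕ → ℝ} {ord p wt : ℕ → ℕ}
    (h17 : s.var 17 = n) (h18 : s.var 18 = n * M) (h19 : s.var 19 = m₀) (hm₀ : m₀ < M)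
    (hM : s.var 9 = M) (hout : ∀ v < n, s.arr 1 v = 0) (hord : s.arr 4 = ord)
    (hlt : ∀ i < n, ord i < n) (hwt : ∀ v < n, s.arr 5 (s.arr 0 v) = wt v)
    (hp : s.arr 6 = p) (hpM : ∀ v < n, s.arr 7 v = p v * M)
    (hpred : ∀ v < n, IsPred lam ρ n ord v (p v)) (hle : ∀ v < n, lam v ≤ ρ v)
    (htab : ∀ r ≤ n, ∀ m < M, s.arr 8 (r * M + m) = minSize K ord p wt r m)
    (hK : minSize K ord p wt n m₀ ≤ K) :
    Runs inp traceback s (60 * n + 20) (fun s' => ∃ X : Finset (Fin n),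
      (X = Finset.univ.filter fun v : Fin n => s'.arr 1 v ≠ 0) ∧ Separated lam ρ X ∧
      ∑ v ∈ X, wt v = m₀ ∧ X.card ≤ K) := by
  refine wp_loop (fun u => u.var 17 ≤ n ∧ u.var 18 = u.var 17 * M ∧ u.var 19 < M ∧
    TraceInv n K lam ρ ord p wt m₀ (minSize K ord p wt n m₀) (u.var 17) (u.var 19)
      (Finset.univ.filter fun v : Fin n => u.arr 1 v ≠ 0))
    -- Every pass lowers the row, by one or by a jump to `p (ord i) ≤ i`.
    (fun u => 60 * u.var 17) ?_ (fun u hF hI hb => ?_) (fun u t hF hI hb ht => ?_)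
  · have he : (Finset.univ.filter fun v : Fin n => s.arr 1 v ≠ 0) = ∅ :=
      Finset.filter_eq_empty_iff.2 fun v _ => by simp [hout v v.2]
    rw [he, h17, h19]
    exact ⟨le_rfl, h18, hm₀, fun u hu => absurd hu (by simp), fun u hu => absurd hu (by simp),
      by simp, by simp, hK⟩
  · have h9 : u.var 9 = M := (hF.var 9 rfl).trans hM
    have a0 : u.arr 0 = s.arr 0 := hF.arr 0 rfl
    have a4 : u.arr 4 = ord := (hF.arr 4 rfl).trans hord
    have a5 : u.arr 5 = s.arr 5 := hF.arr 5 rfl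
    have a6 : u.arr 6 = p := (hF.arr 6 rfl).trans hp
    have a7 : u.arr 7 = s.arr 7 := hF.arr 7 rfl
    have a8 : u.arr 8 = s.arr 8 := hF.arr 8 rfl
    simp only [Test.Holds, Expr.eval] at hb
    obtain ⟨hin, e18, e19, hT⟩ := hI
    obtain ⟨i, hi⟩ : ∃ i, u.var 17 = i + 1 := ⟨u.var 17 - 1, by omega⟩
    rw [hi] at hin e18 hT
    have hiM : (i + 1) * M = i * M + M := by ring
    have e18' : u.var 18 - M = i * M := by omega
    have hv := hlt i (by omega)
    have hpi := IsPred.le_index (hpred _ hv) (by omega) rfl (hle _ hv)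
    refine wp_seq (wp_assign (wp_seq (wp_assign (wp_branch (fun hc => wp_skip ?_) fun hc =>
      wp_seq (wp_assign (wp_seq (wp_store (wp_seq (wp_assign (wp_seq (wp_assign
        (wp_assign ?_)))))))))))) <;>
      simp [Test.Holds, Expr.eval, h9, e18', hi, a8, htab i (by omega) _ e19] at hc <;>
      rw [← hiM, htab (i + 1) hin _ e19] at hc
    · refine ⟨⟨?_, ?_, ?_, ?_⟩, ?_⟩
      · simp [Expr.eval, hi]; omega
      · simp [Expr.eval, hi, h9, e18']
      · simpa [Expr.eval]
      · simpa [Expr.eval, hi] using hT.skip hc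
      · simp [Expr.eval, Expr.cost, Test.cost, hi]; omega
    · have hT' := hT.take hle hpred (by omega) hv hc
      refine ⟨⟨?_, ?_, ?_, ?_⟩, ?_⟩
      · simp [Expr.eval, hi, a4, a6]; omega
      · simp [Expr.eval, hi, a4, a6, a7, hpM _ hv]
      · simp [Expr.eval]; omega
      · convert hT' using 1
        · simp [Expr.eval, hi, a4, a6]
        · simp [Expr.eval, hi, a4, a5, a0, hwt _ hv]
        · ext v
          simp [Expr.eval, hi, a4, Function.update_apply, Fin.ext_iff]
          split_ifs <;> simp [*]
      · simp [Expr.eval, Expr.cost, Test.cost, hi, a4, a6]; omega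
  · simp only [Test.Holds, Expr.eval] at hb
    obtain ⟨hin, e18, e19, hT⟩ := hI
    have h0 : u.var 17 = 0 := by omega
    rw [h0] at hT
    obtain ⟨g1, g2, g3⟩ := hT.zero
    refine ⟨⟨_, rfl, g1, g2, by rw [g3]; exact hK⟩, ?_⟩
    simp [Expr.cost, Test.cost, h17] at ht
    omega

end RAM

/-! ### The complete program and its running time -/

namespace RAM

/-- The program for instances with at least one vertex. -/
def solve : Program :=
  .seq (mergeSort 0 3)
  (.seq (mergeSort 1 4)
  (.seq powers
  (.seq predecessors
  (.seq table
  (.seq (.assign 19 (.sub (.var 9) (.num 1)))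
  (.branch (.lt (.var 10) (.get 8 (.add (.var 18) (.var 19))))
    (.assign 0 (.num 0))
    (.seq traceback (.assign 0 (.num 1)))))))))

/-- The program that computes balanced independent sets of interval graphs. -/
def balancedIndepSet : Program :=
  -- For `n = 0` only constant time is allowed, which computing the powers would exceed. The empty
  -- set is then a solution unless both `k` and `f` are positive.
  .branch (.eq (.var 0) (.num 0))
    (.branch (.and (.not (.eq (.var 1) (.num 0))) (.not (.eq (.var 2) (.num 0))))
      (.assign 0 (.num 0)) (.assign 0 (.num 1)))
    solve

variable {n k f : ℕ} {G : SimpleGraph (Fin n)}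

theorem readAnswer_eq_some {s : State} {X : Finset (Fin n)} (h : s.var 0 ≠ 0)
    (hX : ∀ v, v ∈ X ↔ s.arr 1 (v : ℕ) ≠ 0) : readAnswer n s = some X := by
  rw [readAnswer, if_neg h]
  congr 1
  ext v
  simp [hX]

theorem solve_spec (R : IntervalRep G) (γ : Fin n → Fin k) :
    Runs R.inputReals solve (initialState γ f)
      (2 * ((150 * n + 100) * (Nat.clog 2 n + 1)) + 50 * (k * (f + 1)) + 120 * n +
        150 * ((f + 1) ^ k * n) + 30 * (f + 1) ^ k + 150)
      (fun s => IsCorrectAnswer G γ f (readAnswer n s)) := by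
  set s₀ := initialState γ f with hs₀
  set wt : ℕ → ℕ := fun v => (f + 1) ^ (s₀.arr 0 v) with hwt
  have hwγ : ∀ v : Fin n, wt v = (f + 1) ^ (γ v : ℕ) := fun v => by
    simp [hwt, hs₀, initialState]
  have hγk : ∀ v < n, s₀.arr 0 v < k := fun v hv => by simp [hs₀, initialState, hv]
  have hM0 : 0 < (f + 1) ^ k := by positivity
  have hle : ∀ v < n, R.inputReals 0 v ≤ R.inputReals 1 v := fun v hv => by
    simpa [IntervalRep.inputReals, hv] using R.left_le_right ⟨v, hv⟩
  refine wp_seq ((mergeSort_spec (by norm_num) (n := n) rfl).wp fun s₁ t₁ hF₁ hI₁ ht₁ => ?_)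
  refine wp_seq ((mergeSort_spec (by norm_num) (n := n) (hF₁.var 0 rfl)).wp fun s₂ t₂ hF₂ hI₂ ht₂ => ?_)
  have n₂ : s₂.var 0 = n := (hF₂.var 0 rfl).trans (hF₁.var 0 rfl)
  have k₂ : s₂.var 1 = k := (hF₂.var 1 rfl).trans (hF₁.var 1 rfl)
  have f₂ : s₂.var 2 = f := (hF₂.var 2 rfl).trans (hF₁.var 2 rfl)
  have c₂ : s₂.arr 0 = s₀.arr 0 := (hF₂.arr 0 rfl).trans (hF₁.arr 0 rfl)
  have o₂ : s₂.arr 1 = s₀.arr 1 := (hF₂.arr 1 rfl).trans (hF₁.arr 1 rfl)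
  rw [← hF₂.arr 3 rfl] at hI₁
  refine wp_seq ((powers_spec k₂ f₂).wp fun s₃ t₃ hF₃ hI₃ ht₃ => ?_)
  obtain ⟨hM₃, hK₃, hpow⟩ := hI₃
  rw [← hF₃.arr 3 rfl] at hI₁
  rw [← hF₃.arr 4 rfl] at hI₂
  have n₃ : s₃.var 0 = n := (hF₃.var 0 rfl).trans n₂
  refine wp_seq ((predecessors_spec n₃ hM₃ hI₁ hI₂).wp fun s₄ t₄ hF₄ hI₄ ht₄ => ?_)
  have n₄ : s₄.var 0 = n := (hF₄.var 0 rfl).trans n₃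
  have M₄ : s₄.var 9 = (f + 1) ^ k := (hF₄.var 9 rfl).trans hM₃
  have K₄ : s₄.var 10 = k * f := (hF₄.var 10 rfl).trans hK₃
  have c₄ : s₄.arr 0 = s₀.arr 0 := (hF₄.arr 0 rfl).trans ((hF₃.arr 0 rfl).trans c₂)
  have o₄ : s₄.arr 1 = s₀.arr 1 := (hF₄.arr 1 rfl).trans ((hF₃.arr 1 rfl).trans o₂)
  have w₄ : ∀ v < n, s₄.arr 5 (s₄.arr 0 v) = wt v := fun v hv => by
    rw [c₄, hF₄.arr 5 rfl, hpow _ (hγk v hv)]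
  rw [← hF₄.arr 4 rfl] at hI₂ hI₄
  generalize hord : s₄.arr 4 = ord at *
  generalize hp : s₄.arr 6 = p at *
  have hpred : ∀ v < n, IsPred (R.inputReals 0) (R.inputReals 1) n ord v (p v) :=
    fun v hv => (hI₄ v hv).1
  have hpM : ∀ v < n, s₄.arr 7 v = p v * (f + 1) ^ k := fun v hv => (hI₄ v hv).2
  refine wp_seq ((table_spec n₄ M₄ hM0 K₄ hord hI₂.lt w₄ hpM fun i hi =>
    IsPred.le_index (hpred _ (hI₂.lt i hi)) hi rfl (hle _ (hI₂.lt i hi))).wp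
      fun s₅ t₅ hF₅ hI₅ ht₅ => ?_)
  obtain ⟨h17, h18, h8⟩ := hI₅
  have M₅ : s₅.var 9 = (f + 1) ^ k := (hF₅.var 9 rfl).trans M₄
  have K₅ : s₅.var 10 = k * f := (hF₅.var 10 rfl).trans K₄
  have hlast := h8 n le_rfl ((f + 1) ^ k - 1) (by omega)
  refine wp_seq (wp_assign (wp_branch (fun hb => wp_assign ⟨?_, ?_⟩) fun hb => wp_seq ?_))
  · simp [Test.Holds, Expr.eval, M₅, K₅, h18, hlast] at hb
    simp only [readAnswer, State.setVar_var, Expr.eval, if_true, IsCorrectAnswer]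
    rintro ⟨S, hS, hbal⟩
    rw [R.isIndepSet_iff] at hS
    rw [balanced_iff] at hbal
    -- A balanced set would push the entry for the target weight down to at most `k * f`, against
    -- the test.
    have := minSize_le_card (K := k * f) (wt := wt) hI₂ hle hpred n le_rfl S hS fun v _ => by
      obtain ⟨j, hj, e⟩ := hI₂.surj v v.2
      exact ⟨j, hj, e⟩
    rw [Finset.sum_congr rfl fun v _ => hwγ v, Nat.eq_sub_of_add_eq hbal.1] at this
    omega
  · simp only [Expr.cost, Test.cost]
    omega
  · simp [Test.Holds, Expr.eval, M₅, K₅, h18, hlast] at hb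
    refine (traceback_spec (n := n) (M := (f + 1) ^ k) (K := k * f) (m₀ := (f + 1) ^ k - 1)
      (lam := R.inputReals 0) (ρ := R.inputReals 1) (ord := ord) (p := p) (wt := wt)
      ?_ ?_ ?_ (by omega) ?_ ?_ ?_ hI₂.lt ?_ ?_ ?_ hpred hle ?_ hb).wp
      fun s₆ t₆ hF₆ hI₆ ht₆ => wp_assign ⟨?_, ?_⟩
    · simpa
    · simpa
    · simp [Expr.eval, M₅]
    · simpa
    · intro v hv
      simp [hF₅.arr 1 rfl, o₄, hs₀, initialState]
    · simp [hF₅.arr 4 rfl, hord]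
    · simpa [hF₅.arr 5 rfl, hF₅.arr 0 rfl] using w₄
    · simp [hF₅.arr 6 rfl, hp]
    · simpa [hF₅.arr 7 rfl] using hpM
    · simpa using h8
    · obtain ⟨X, hX, hsep, hw, hcard⟩ := hI₆
      have : readAnswer n (s₆.setVar 0 (Expr.eval s₆ (.num 1))) = some X := by
        refine readAnswer_eq_some (by simp [Expr.eval]) fun v => ?_
        rw [hX]
        simp
      rw [this]
      refine ⟨(R.isIndepSet_iff X).2 hsep, (balanced_iff γ X).2 ⟨?_, hcard⟩⟩
      rw [← Finset.sum_congr rfl fun v _ => hwγ v, hw]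
      omega
    · simp only [Expr.cost, Test.cost] at ht₆ ⊢
      omega

/-- The factor 2 comes from `log 2 ≥ 1 / 2`. -/
theorem clog_le (n : ℕ) : (Nat.clog 2 n : ℝ) ≤ 2 * Real.log n + 1 := by
  have h1 : Nat.clog 2 n ≤ Nat.log 2 n + 1 :=
    Nat.clog_le_of_le_pow (Nat.lt_pow_succ_log_self (by norm_num) n).le
  have h2 : (Nat.log 2 n : ℝ) ≤ 2 * Real.log n := by
    rcases Nat.eq_zero_or_pos n with rfl | hn
    · simp
    · have h3 : (2 : ℝ) ^ Nat.log 2 n ≤ n := by exact_mod_cast Nat.pow_log_le_self 2 hn.ne'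
      have h4 := Real.log_le_log (by positivity) h3
      rw [Real.log_pow] at h4
      have h5 : (0.5 : ℝ) ≤ Real.log 2 := by linarith [Real.log_two_gt_d9]
      nlinarith [(Nat.cast_nonneg (Nat.log 2 n) : (0 : ℝ) ≤ _)]
  have h6 : (Nat.clog 2 n : ℝ) ≤ Nat.log 2 n + 1 := by exact_mod_cast h1
  linarith

/-- With `n` and `k` positive, `k * (f + 1) ^ k * n` dominates every term except the sorting time
and the constant. -/
theorem time_bound {n k f t : ℕ} (hn : 1 ≤ n) (hk : 1 ≤ k)
    (ht : t ≤ 2 * ((150 * n + 100) * (Nat.clog 2 n + 1)) + 50 * (k * (f + 1)) + 120 * n +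
      150 * ((f + 1) ^ k * n) + 30 * (f + 1) ^ k + 200) :
    (t : ℝ) ≤ (2000 : ℕ) * ((n : ℝ) * Real.log n + (k : ℝ) * ((f : ℝ) + 1) ^ k * n + 1) := by
  have hM : f + 1 ≤ (f + 1) ^ k := Nat.le_self_pow (by omega) _
  generalize hMM : (f + 1) ^ k = M at *
  have h1 : n ≤ k * M * n := Nat.le_mul_of_pos_left _ (Nat.mul_pos hk (by omega))
  have h2 : k * (f + 1) ≤ k * M * n :=
    (Nat.mul_le_mul_left k hM).trans (Nat.le_mul_of_pos_right _ hn)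
  have h3 : M * n ≤ k * M * n := Nat.mul_le_mul_right n (Nat.le_mul_of_pos_left _ hk)
  have h4 : M ≤ M * n := Nat.le_mul_of_pos_right _ hn
  have h5 : (150 * n + 100) * (Nat.clog 2 n + 1) ≤ 250 * n * (Nat.clog 2 n + 1) :=
    Nat.mul_le_mul_right _ (by omega)
  have h6 : t ≤ 500 * (n * Nat.clog 2 n) + 850 * (k * M * n) + 200 := by
    have : 250 * n * (Nat.clog 2 n + 1) = 250 * (n * Nat.clog 2 n) + 250 * n := by ring
    omega
  have h7 : (t : ℝ) ≤ 500 * (n * Nat.clog 2 n) + 850 * (k * M * n) + 200 := by exact_mod_cast h6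
  have h8 : (M : ℝ) = ((f : ℝ) + 1) ^ k := by exact_mod_cast hMM.symm
  have h9 : (n : ℝ) ≤ k * M * n := by exact_mod_cast h1
  have h10 : (n : ℝ) * Nat.clog 2 n ≤ n * (2 * Real.log n + 1) :=
    mul_le_mul_of_nonneg_left (clog_le n) (Nat.cast_nonneg n)
  have h11 : 0 ≤ (n : ℝ) * Real.log n :=
    mul_nonneg (Nat.cast_nonneg n) (Real.log_natCast_nonneg n)
  rw [← h8]
  push_cast
  linarith

end RAM

open RAM in
theorem theorem3 :
    ∃ (P : RAM.Program) (C : ℕ),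
      ∀ (n k f : ℕ) (G : SimpleGraph (Fin n)) (R : IntervalRep G) (γ : Fin n → Fin k),
        ∃ (s : RAM.State) (t : ℕ),
          RAM.Exec R.inputReals P (initialState γ f) s t ∧
          IsCorrectAnswer G γ f (readAnswer n s) ∧
          (t : ℝ) ≤ C * ((n : ℝ) * Real.log n + (k : ℝ) * ((f : ℝ) + 1) ^ k * n + 1) := by
  refine ⟨balancedIndepSet, 2000, fun n k f G R γ => ?_⟩
  suffices h : WP R.inputReals balancedIndepSet (fun s t => IsCorrectAnswer G γ f (readAnswer n s) ∧
      (t : ℝ) ≤ (2000 : ℕ) *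
        ((n : ℝ) * Real.log n + (k : ℝ) * ((f : ℝ) + 1) ^ k * n + 1)) (initialState γ f) 0 by
    obtain ⟨s, t, h, hQ⟩ := h
    exact ⟨s, t, h, by simpa using hQ⟩
  refine wp_branch (fun hn => ?_) fun hn => ?_
  · obtain rfl : n = 0 := hn
    have hempty : ∀ S : Finset (Fin 0), S = ∅ := fun S => Finset.eq_empty_of_isEmpty S
    refine wp_branch (fun hb => wp_assign ⟨?_, ?_⟩) fun hb => wp_assign ⟨?_, ?_⟩
    · simp [Test.Holds, Expr.eval, initialState] at hb
      simp only [readAnswer, State.setVar_var, Expr.eval, if_true, IsCorrectAnswer]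
      rintro ⟨S, -, hS⟩
      have := hS ⟨0, by omega⟩
      rw [hempty S] at this
      simp at this
      omega
    · simp [Expr.cost, Test.cost]; norm_num
    · simp [Test.Holds, Expr.eval, initialState] at hb
      rw [readAnswer_eq_some (X := ∅) (by simp [Expr.eval]) fun v => v.elim0]
      refine ⟨by simp [SimpleGraph.IsIndepSet], fun c => ?_⟩
      have := c.pos
      simp [hb (by omega)]
    · simp [Expr.cost, Test.cost]; norm_num
  · have hn : n ≠ 0 := hn
    -- Some vertex exists and has a color.
    have hk : 1 ≤ k := (γ ⟨0, by omega⟩).pos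
    refine (solve_spec R γ).wp fun s t _ hs ht => ⟨hs, time_bound (by omega) hk ?_⟩
    simp only [Expr.cost, Test.cost] at ht
    omega
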